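/- Let $d\in\{2,3\}$, let $\Omega\subset\mathbb R^d$ be a bounded domain (open and connected), and let $\eta_{\min}>0$. There is a constant $C>0$, depending only on $\Omega$ and $\eta_{\min}$ (in particular not on the time step), such that the following holds. Let $\tau>0$ (time step), $\lambda>0$, and let $(\rho^n,R_\rho^n,\mathbf m^n,\mathbf u^n,p^n)_{n\ge0}$ be sequences with $\rho^n\in W^{1,\infty}(\Omega)$, $\mathbf m^n,\mathbf u^n\in H^1_0(\Omega)^d$, $p^n\in L^2(\Omega)$; let $\mathbf f^n\in L^2(\Omega)^d$. Write $\varepsilon(\mathbf u)=\frac12(\nabla\mathbf u+(\nabla\mathbf u)^{T})$, $\delta\phi^{n+1}=\phi^{n+1}-\phi^n$, and measure $L^2$ and $L^\infty$ norms of vectors and matrices with the Euclidean (for matrices: Frobenius) norm. Put $\rho_{\min}=\min_\Omega\rho^0$, $\rho_{\max}=\max_\Omega\rho^0$ (essential minimum and maximum), assume $\rho_{\min}>0$, and let $\eta$ be Lipschitz on $[\rho_{\min},\rho_{\max}]$ with $\eta\ge\eta_{\min}$ there; write $\eta^n=\eta(\rho^n)$. Let $$\bar\nu=1.1\,\|\eta(\rho^0)/\rho^0\|_{L^\infty},\qquad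 \bar\lambda=1.1\,\lambda\,\|1/\rho^0\|_{L^\infty}.$$ Assume $\mathbf m^0=\rho^0\mathbf u^0$ and, for all $n\ge0$, with $\mathbf m^{*,n}=\rho^{n+1}\mathbf u^n$, $$\frac{\delta\rho^{n+1}}{\tau}+\mathbf u^n\cdot\nabla\rho^n=R_\rho^{n+1},$$ $$\frac{\delta\mathbf m^{n+1}}{\tau}-2\bar\nu\,\mathrm{div}\,\varepsilon(\mathbf m^{n+1}-\mathbf m^{*,n})-2\,\mathrm{div}(\eta^{n+1}\varepsilon(\mathbf u^n))-\bar\lambda\nabla\mathrm{div}(\mathbf m^{n+1}-\mathbf m^{*,n})-\lambda\nabla\mathrm{div}\,\mathbf u^n+\nabla p^n+\mathrm{div}(\rho^n\mathbf u^{n+1}\otimes\mathbf u^n)-\tfrac12\rho^n\mathbf u^{n+1}\mathrm{div}\,\mathbf u^n-\tfrac12\mathbf u^{n+1}R_\rho^{n+1}=\mathbf f^{n+1}$$ in the sense of distributions on $\Omega$, where $(\mathrm{div}\,T)_i=\sum_j\partial_jT_{ij}$, and $$\mathbf u^{n+1}=\frac{1}{\rho^{n+1}}\mathbf m^{n+1},\qquad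 p^{n+1}=p^n-\lambda\,\mathrm{div}\,\mathbf u^{n+1}.$$ Let $c_3$ be a constant such that $\|\sqrt w\,\mathrm{div}\,\mathbf v\|_{L^2}\le c_3\|\sqrt w\,\varepsilon(\mathbf v)\|_{L^2}$ for all $\mathbf v\in H^1(\Omega)^d$ and all measurable weights $w$ bounded from above and away from zero, and let $\gamma_1\in(0,\frac1{\sqrt2})$, $\gamma_2\in(0,\frac1{\sqrt2c_3})$, $\gamma_3,\gamma_4\in(0,1)$. Assume for all $n\ge0$ that $\rho_{\min}\le\rho^n\le\rho_{\max}$ a.e. in $\Omega$, and $$\tau^{1/2}\Big\|\frac{2\sqrt2\,\bar\nu}{\sqrt{\rho^n\eta^{n+1}}}\nabla\rho^{n+1}\Big\|_{L^\infty}\le\gamma_1,\quad \tau^{1/2}\Big\|\frac{\sqrt2\,\bar\lambda}{\sqrt{\rho^n\eta^{n+1}}}\nabla\rho^{n+1}\Big\|_{L^\infty}\le\gamma_2,\quad \Big\|\frac{\bar\nu\,\delta\rho^{n+1}}{\eta^{n+1}}\Big\|_{L^\infty}\le\gamma_3,\quad \Big\|\frac{\bar\lambda\,\delta\rho^{n+1}}{\lambda}\Big\|_{L^\infty}\le\gamma_4.$$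 Then for all $n\ge0$ $$\|\sqrt{\rho^{n+1}}\mathbf u^{n+1}\|_{L^2}^2+2\tau\bar\nu\|\sqrt{\rho^{n+1}}\varepsilon(\mathbf u^{n+1})\|_{L^2}^2+\tau\bar\lambda\|\sqrt{\rho^{n+1}}\mathrm{div}\,\mathbf u^{n+1}\|_{L^2}^2+\frac\tau\lambda\|p^{n+1}\|_{L^2}^2+\tau\|\sqrt{\eta^{n+1}}\varepsilon(\mathbf u^{n+1})\|_{L^2}^2$$ $$\le\|\sqrt{\rho^{n}}\mathbf u^{n}\|_{L^2}^2+2\tau\bar\nu\|\sqrt{\rho^{n}}\varepsilon(\mathbf u^{n})\|_{L^2}^2+\tau\bar\lambda\|\sqrt{\rho^{n}}\mathrm{div}\,\mathbf u^{n}\|_{L^2}^2+\frac\tau\lambda\|p^{n}\|_{L^2}^2+2\tau\|\mathbf f^{n+1}\|_{L^2}\|\mathbf u^{n+1}\|_{L^2},$$ and, as a result, for all $n\ge0$ $$\|\sqrt{\rho^{n+1}}\mathbf u^{n+1}\|_{L^2}^2\le\|\sqrt{\rho^{0}}\mathbf u^{0}\|_{L^2}^2+2\tau\bar\nu\|\sqrt{\rho^{0}}\varepsilon(\mathbf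 u^{0})\|_{L^2}^2+\tau\bar\lambda\|\sqrt{\rho^{0}}\mathrm{div}\,\mathbf u^{0}\|_{L^2}^2+\frac\tau\lambda\|p^{0}\|_{L^2}^2+C\tau\sum_{k=0}^n\|\mathbf f^{k+1}\|_{L^2}^2.$$ -/

import Mathlib

open MeasureTheory
open scoped ENNReal NNReal ContDiff

noncomputable section

namespace VarDensityNS

/-- Euclidean space of dimension `d`. -/
abbrev E (d : ℕ) := EuclideanSpace ℝ (Fin d)

/-- The `j`-th vector of the standard basis. -/
abbrev stdVec {d : ℕ} (j : Fin d) : E d := EuclideanSpace.single j 1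

/-- Lebesgue measure on the domain `Ω`. -/
abbrev vol {d : ℕ} (Ω : Set (E d)) : Measure (E d) := volume.restrict Ω

/-! ### Sobolev spaces through weak derivatives -/

/-- Smooth functions with compact support contained in `Ω`. -/
def IsTest {d : ℕ} {F : Type*} [NormedAddCommGroup F] [NormedSpace ℝ F]
    (Ω : Set (E d)) (φ : E d → F) : Prop :=
  ContDiff ℝ ∞ φ ∧ HasCompactSupport φ ∧ tsupport φ ⊆ Ω

/-- `g'` is a weak partial derivative of `g` in the direction `j` on the open set `Ω`. -/
def IsWeakDeriv {d : ℕ} (Ω : Set (E d)) (j : Fin d) (g g' : E d → ℝ) : Prop :=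
  LocallyIntegrableOn g Ω volume ∧ LocallyIntegrableOn g' Ω volume ∧
    ∀ φ : E d → ℝ, IsTest Ω φ →
      ∫ x in Ω, g x * fderiv ℝ φ x (stdVec j) = -∫ x in Ω, g' x * φ x

open Classical in
/-- The weak partial derivative `∂_j g` on `Ω`: it is unique up to null sets when it exists. -/
def weakDeriv {d : ℕ} (Ω : Set (E d)) (j : Fin d) (g : E d → ℝ) : E d → ℝ :=
  if h : ∃ g', IsWeakDeriv Ω j g g' then h.choose else 0

/-- The Sobolev space `W^{1,p}(Ω)` of scalar functions. -/
def MemW1 {d : ℕ} (Ω : Set (E d)) (p : ℝ≥0∞) (g : E d → ℝ) : Prop :=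
  MemLp g p (vol Ω) ∧ ∀ j : Fin d, ∃ g', IsWeakDeriv Ω j g g' ∧ MemLp g' p (vol Ω)

/-- The space `H¹₀(Ω)` of scalar functions: the closure of the test functions in `H¹(Ω)`. -/
def MemH10 {d : ℕ} (Ω : Set (E d)) (g : E d → ℝ) : Prop :=
  MemW1 Ω 2 g ∧ ∀ ε : ℝ, 0 < ε → ∃ φ : E d → ℝ, IsTest Ω φ ∧
    lpNorm (fun x => g x - φ x) 2 (vol Ω) < ε ∧
    ∀ j : Fin d, lpNorm (fun x => weakDeriv Ω j g x - fderiv ℝ φ x (stdVec j)) 2 (vol Ω) < ε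

/-- The space `H¹(Ω)` of vector fields. -/
def MemH1Vec {d : ℕ} (Ω : Set (E d)) (v : E d → E d) : Prop :=
  ∀ i : Fin d, MemW1 Ω 2 (fun x => v x i)

/-- The space `H¹₀(Ω)` of vector fields. -/
def MemH10Vec {d : ℕ} (Ω : Set (E d)) (v : E d → E d) : Prop :=
  ∀ i : Fin d, MemH10 Ω (fun x => v x i)

/-! ### Differential operators -/

/-- The weak gradient of a scalar function. -/
def grad {d : ℕ} (Ω : Set (E d)) (g : E d → ℝ) (x : E d) : E d :=
  WithLp.toLp 2 (fun j => weakDeriv Ω j g x)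

/-- The weak gradient `(∂_j v_i)_{ij}` of a vector field. -/
def jac {d : ℕ} (Ω : Set (E d)) (v : E d → E d) (x : E d) : Matrix (Fin d) (Fin d) ℝ :=
  Matrix.of fun i j => weakDeriv Ω j (fun y => v y i) x

/-- The strain rate tensor `ε(v) = (∇v + (∇v)ᵀ) / 2`. -/
def strain {d : ℕ} (Ω : Set (E d)) (v : E d → E d) (x : E d) : Matrix (Fin d) (Fin d) ℝ :=
  (1 / 2 : ℝ) • (jac Ω v x + (jac Ω v x).transpose)

/-- The weak divergence of a vector field. -/
def dvg {d : ℕ} (Ω : Set (E d)) (v : E d → E d) (x : E d) : ℝ :=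
  ∑ i : Fin d, weakDeriv Ω i (fun y => v y i) x

/-- The classical gradient `(∂_j φ_i)_{ij}` of a test field. -/
def testJac {d : ℕ} (φ : E d → E d) (x : E d) : Matrix (Fin d) (Fin d) ℝ :=
  Matrix.of fun i j => (fderiv ℝ φ x (stdVec j)) i

/-- The classical divergence of a test field. -/
def testDvg {d : ℕ} (φ : E d → E d) (x : E d) : ℝ :=
  ∑ i : Fin d, (fderiv ℝ φ x (stdVec i)) i

/-- The double contraction `A : B`. -/
def contr {d : ℕ} (A B : Matrix (Fin d) (Fin d) ℝ) : ℝ := ∑ i, ∑ j, A i j * B i j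

/-- The matrix norm `(A : A)^{1/2}`. -/
def frob {d : ℕ} (A : Matrix (Fin d) (Fin d) ℝ) : ℝ := √(contr A A)

/-! ### Weighted norms and constants -/

/-- `‖√w v‖_{L²(Ω)}` for a vector field `v`. -/
def normVec {d : ℕ} (Ω : Set (E d)) (w : E d → ℝ) (v : E d → E d) : ℝ :=
  lpNorm (fun x => √(w x) • v x) 2 (vol Ω)

/-- `‖√w ε(v)‖_{L²(Ω)}`. -/
def normStrain {d : ℕ} (Ω : Set (E d)) (w : E d → ℝ) (v : E d → E d) : ℝ :=
  lpNorm (fun x => √(w x) * frob (strain Ω v x)) 2 (vol Ω)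

/-- `‖√w div v‖_{L²(Ω)}`. -/
def normDvg {d : ℕ} (Ω : Set (E d)) (w : E d → ℝ) (v : E d → E d) : ℝ :=
  lpNorm (fun x => √(w x) * dvg Ω v x) 2 (vol Ω)

/-- `c` is a constant such that `‖√w div v‖_{L²} ≤ c ‖√w ε(v)‖_{L²}` for all `v ∈ H¹(Ω)` and all
weights `w` that are bounded from above and away from zero. -/
def IsDivStrainConst {d : ℕ} (Ω : Set (E d)) (c : ℝ) : Prop :=
  ∀ w : E d → ℝ, AEStronglyMeasurable w (vol Ω) →
    (∃ a b : ℝ, 0 < a ∧ ∀ᵐ x ∂(vol Ω), a ≤ w x ∧ w x ≤ b) →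
    ∀ v : E d → E d, MemH1Vec Ω v → normDvg Ω w v ≤ c * normStrain Ω w v

/-- `ν̄ = 1.1 ‖η(ρ⁰)/ρ⁰‖_{L^∞}`. -/
def nuBar {d : ℕ} (Ω : Set (E d)) (η : ℝ → ℝ) (ρ₀ : E d → ℝ) : ℝ :=
  1.1 * lpNorm (fun x => η (ρ₀ x) / ρ₀ x) ∞ (vol Ω)

/-- `λ̄ = 1.1 λ ‖1/ρ⁰‖_{L^∞}`. -/
def lamBar {d : ℕ} (Ω : Set (E d)) (lam : ℝ) (ρ₀ : E d → ℝ) : ℝ :=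
  1.1 * lam * lpNorm (fun x => 1 / ρ₀ x) ∞ (vol Ω)

/-- `ρ_min`, the (essential) minimum of the initial density. -/
def rhoMin {d : ℕ} (Ω : Set (E d)) (ρ₀ : E d → ℝ) : ℝ := essInf ρ₀ (vol Ω)

/-- `ρ_max`, the (essential) maximum of the initial density. -/
def rhoMax {d : ℕ} (Ω : Set (E d)) (ρ₀ : E d → ℝ) : ℝ := essSup ρ₀ (vol Ω)

/-! ### The scheme -/

/-- The density is updated by `(ρⁿ⁺¹ - ρⁿ)/τ + uⁿ·∇ρⁿ = Rⁿ⁺¹`. -/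
def DensityStep {d : ℕ} (Ω : Set (E d)) (τ : ℝ) (ρ ρ' R' : E d → ℝ) (u : E d → E d) : Prop :=
  ∀ᵐ x ∂(vol Ω), (ρ' x - ρ x) / τ + inner ℝ (u x) (grad Ω ρ x) = R' x

/-- The momentum equation of one time step, in the sense of distributions on `Ω`. Unprimed data are
taken at time `tₙ` and primed data at time `tₙ₊₁`. -/
def MomentumStep {d : ℕ} (Ω : Set (E d)) (η : ℝ → ℝ) (τ lam nub lamb : ℝ)
    (ρ p ρ' R' : E d → ℝ) (m u m' u' f' : E d → E d) : Prop :=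
  ∀ φ : E d → E d, IsTest Ω φ →
    (∫ x in Ω, inner ℝ ((1 / τ) • (m' x - m x)) (φ x))
    + (∫ x in Ω, 2 * nub * contr (strain Ω (fun y => m' y - ρ' y • u y) x) (testJac φ x))
    + (∫ x in Ω, 2 * η (ρ' x) * contr (strain Ω u x) (testJac φ x))
    + (∫ x in Ω, lamb * dvg Ω (fun y => m' y - ρ' y • u y) x * testDvg φ x)
    + (∫ x in Ω, lam * dvg Ω u x * testDvg φ x)
    - (∫ x in Ω, p x * testDvg φ x)
    - (∫ x in Ω, ρ x * contr (Matrix.of fun i j => u' x i * u x j) (testJac φ x))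
    - (∫ x in Ω, 1 / 2 * ρ x * dvg Ω u x * inner ℝ (u' x) (φ x))
    - (∫ x in Ω, 1 / 2 * R' x * inner ℝ (u' x) (φ x))
    = ∫ x in Ω, inner ℝ (f' x) (φ x)

/-- `(ρⁿ, Rⁿ, mⁿ, uⁿ, pⁿ)` is generated by the semi-implicit momentum-pressure scheme with
homogeneous Dirichlet conditions, time step `τ`, compressibility parameter `lam` and sources `fⁿ`.
The structure holds the function spaces and the four steps of the scheme, nothing else. -/
structure IsSchemeSolution {d : ℕ} (Ω : Set (E d)) (η : ℝ → ℝ) (τ lam : ℝ)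
    (ρ R p : ℕ → E d → ℝ) (m u f : ℕ → E d → E d) : Prop where
  density_mem : ∀ n, MemW1 Ω ∞ (ρ n)
  momentum_mem : ∀ n, MemH10Vec Ω (m n)
  velocity_mem : ∀ n, MemH10Vec Ω (u n)
  pressure_mem : ∀ n, MemLp (p n) 2 (vol Ω)
  momentum_init : ∀ᵐ x ∂(vol Ω), m 0 x = ρ 0 x • u 0 x
  density_step : ∀ n, DensityStep Ω τ (ρ n) (ρ (n + 1)) (R (n + 1)) (u n)
  momentum_step : ∀ n, MomentumStep Ω η τ lam (nuBar Ω η (ρ 0)) (lamBar Ω lam (ρ 0))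
    (ρ n) (p n) (ρ (n + 1)) (R (n + 1)) (m n) (u n) (m (n + 1)) (u (n + 1)) (f (n + 1))
  velocity_step : ∀ n, ∀ᵐ x ∂(vol Ω), u (n + 1) x = (1 / ρ (n + 1) x) • m (n + 1) x
  pressure_step : ∀ n, ∀ᵐ x ∂(vol Ω), p (n + 1) x = p n x - lam * dvg Ω (u (n + 1)) x

end VarDensityNS

end

open VarDensityNS

namespace VarDensityNS

variable {d : ℕ} {Ω : Set (E d)}

/-! ### Hölder exponents -/

/-! The momentum equation is tested with `2τu'`, where unprimed quantities belong to the old time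
level and primed ones to the new. Three cancellations produce the energy balance.

Inertia: polarization of `u·u'`, the density equation and the identity `∫ ∂_j(ρ u_j (u'_i)²) = 0`
turn the time derivative, convection and the two half-weighted corrections into `ρ'|u'|² - ρ|u|² +
ρ|u' - u|²`. The last term is numerical dissipation.

Viscosity: the implicit part acts on `m' - ρ'u = ρ'(u' - u)`, whose gradient is `ρ'∇(u' - u) + (u' -
u) ⊗ ∇ρ'`. Polarization of `ε(u):ε(u')` gives the new viscous energy, the dissipation `2τη|ε(u')|²`,
and remainders with the factors `ν̄ρ' - η` and `η - ν̄(ρ' - ρ)`. Both are nonnegative: the second by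
the bound on the density increment, the first by the choice of `ν̄`. The divergence terms behave
alike, and the square in the pressure update supplies the term `τλ(div u')²`.

Density gradients: the products of `(u' - u) ⊗ ∇ρ'` with `ε(u')` and `div u'` are split by Young's
inequality. Each uses half of `ρ|u' - u|²`, and the time step conditions bound the rest by
`γ₁²τη|ε(u')|²` and `γ₂²τη(div u')²`. Since `γ₁² ≤ 1/2` and `γ₂²c₃² ≤ 1/2`, they cost at most half
of the viscous dissipation after integration. This algebra is pointwise: `scalar_energy_le` and
`pointwise_energy_le`.

Two analytic points remain. First, `u'` is only in `H¹₀`, whereas the equation is tested with smooth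
fields. For `d ≤ 3` the Sobolev inequality puts `H¹₀` in `L⁴`, so zeroth-order terms in `L^{4/3}`
and fluxes in `L²` pass to the limit (`MemH10.integral_eq_zero_of_forall_isTest`). Second, `ν̄` sees
only the values of `ρ⁰`, but `η(r) ≤ ν̄r` is needed at later densities. On a connected domain a
`W^{1,∞}` function has no gap in its essential range, so the bound holds on all of `[ρ_min, ρ_max]`
(`MemW1.abs_le_lpNorm_comp`).

For the accumulated bound, Korn and Poincaré control `‖u'‖²` by the remaining dissipation. Young's
inequality absorbs the force, and the one-step inequalities telescope. -/

theorem holderTriple_four_four_two : ENNReal.HolderTriple 4 4 2 := by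
  refine ⟨?_⟩
  rw [← two_mul, show (4 : ℝ≥0∞) = 2 * 2 by norm_num,
    ENNReal.mul_inv (by simp) (by simp), ← mul_assoc, ENNReal.mul_inv_cancel (by simp) (by simp),
    one_mul]

theorem holderTriple_four_two : ENNReal.HolderTriple 4 2 (4 / 3) := by
  refine ⟨?_⟩
  rw [ENNReal.inv_div (by simp) (by simp), show (2 : ℝ≥0∞)⁻¹ = 2 / 4 by
    rw [show (4 : ℝ≥0∞) = 2 * 2 by norm_num, ENNReal.div_eq_inv_mul,
      ENNReal.mul_inv (by simp) (by simp), mul_assoc, ENNReal.inv_mul_cancel (by simp) (by simp),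
      mul_one], ← one_div, ENNReal.div_add_div_same]
  norm_num

theorem holderTriple_four_thirds_four : ENNReal.HolderTriple (4 / 3) 4 1 := by
  refine ⟨?_⟩
  rw [ENNReal.inv_div (by simp) (by simp), ← one_div (4 : ℝ≥0∞), ENNReal.div_add_div_same, inv_one]
  norm_num
  exact ENNReal.div_self (by simp) (by simp)

theorem memLp_mul_of_holder {α : Type*} [MeasurableSpace α] {μ : Measure α} {p q r : ℝ≥0∞}
    (h : ENNReal.HolderTriple p q r) {f g : α → ℝ} (hf : MemLp f p μ) (hg : MemLp g q μ) :
    MemLp (fun x => f x * g x) r μ :=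
  hg.mul hf

theorem memLp_mul_of_top {α : Type*} [MeasurableSpace α] {μ : Measure α} {p : ℝ≥0∞}
    {f g : α → ℝ} (hf : MemLp f ∞ μ) (hg : MemLp g p μ) :
    MemLp (fun x => f x * g x) p μ :=
  hg.mul (hpqr := inferInstance) hf

theorem integrable_mul_two {α : Type*} [MeasurableSpace α] {μ : Measure α}
    {f g : α → ℝ} (hf : MemLp f 2 μ) (hg : MemLp g 2 μ) :
    Integrable (fun x => f x * g x) μ :=
  memLp_one_iff_integrable.1 (memLp_mul_of_holder inferInstance hf hg)

theorem integrable_mul_four_thirds {α : Type*} [MeasurableSpace α] {μ : Measure α}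
    {f g : α → ℝ} (hf : MemLp f (4 / 3) μ) (hg : MemLp g 4 μ) :
    Integrable (fun x => f x * g x) μ :=
  memLp_one_iff_integrable.1 (memLp_mul_of_holder holderTriple_four_thirds_four hf hg)

theorem abs_integral_mul_le_lpNorm {α : Type*} [MeasurableSpace α] {μ : Measure α} {p q : ℝ≥0∞}
    (h : ENNReal.HolderTriple p q 1) {f g : α → ℝ} (hf : MemLp f p μ) (hg : MemLp g q μ) :
    |∫ x, f x * g x ∂μ| ≤ lpNorm f p μ * lpNorm g q μ := by
  have hfg : MemLp (fun x => f x * g x) 1 μ := memLp_mul_of_holder h hf hg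
  calc |∫ x, f x * g x ∂μ| ≤ ∫ x, ‖f x * g x‖ ∂μ := by
        rw [← Real.norm_eq_abs]; exact norm_integral_le_integral_norm _
    _ = lpNorm (fun x => f x * g x) 1 μ := (lpNorm_one_eq_integral_norm hfg.1).symm
    _ = (eLpNorm (f • g) 1 μ).toReal := (toReal_eLpNorm hfg.1).symm
    _ ≤ (eLpNorm f p μ * eLpNorm g q μ).toReal :=
      ENNReal.toReal_mono (ENNReal.mul_ne_top hf.2.ne hg.2.ne)
        (eLpNorm_smul_le_mul_eLpNorm hg.1 hf.1)
    _ = _ := by rw [ENNReal.toReal_mul, toReal_eLpNorm hf.1, toReal_eLpNorm hg.1]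

/-! ### Test functions -/

namespace IsTest

variable {φ ψ : E d → ℝ}

theorem fderiv_apply (hφ : IsTest Ω φ) (v : E d) : IsTest Ω (fun x => fderiv ℝ φ x v) :=
  ⟨(hφ.1.fderiv_right (m := ∞) (by simp)).clm_apply contDiff_const, hφ.2.1.fderiv_apply ℝ v,
    (tsupport_fderiv_apply_subset ℝ v).trans hφ.2.2⟩

theorem sub (hφ : IsTest Ω φ) (hψ : IsTest Ω ψ) : IsTest Ω (fun x => φ x - ψ x) :=
  ⟨hφ.1.sub hψ.1, hφ.2.1.sub hψ.2.1,
    (tsupport_sub φ ψ).trans (Set.union_subset hφ.2.2 hψ.2.2)⟩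

theorem mul (hφ : IsTest Ω φ) (hψ : IsTest Ω ψ) : IsTest Ω (fun x => φ x * ψ x) :=
  ⟨hφ.1.mul hψ.1, hφ.2.1.mul_right, (tsupport_mul_subset_left).trans hφ.2.2⟩

theorem differentiable (hφ : IsTest Ω φ) : Differentiable ℝ φ := hφ.1.differentiable (by simp)

theorem memLp (hφ : IsTest Ω φ) (p : ℝ≥0∞) : MemLp φ p (vol Ω) :=
  hφ.1.continuous.memLp_of_hasCompactSupport hφ.2.1

theorem eq_zero_of_notMem (hφ : IsTest Ω φ) {x : E d} (hx : x ∉ Ω) : φ x = 0 :=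
  image_eq_zero_of_notMem_tsupport fun h => hx (hφ.2.2 h)

theorem fderiv_mul (hφ : IsTest Ω φ) (hψ : IsTest Ω ψ) (x v : E d) :
    fderiv ℝ (fun x => φ x * ψ x) x v = φ x * fderiv ℝ ψ x v + fderiv ℝ φ x v * ψ x := by
  rw [fderiv_fun_mul (hφ.differentiable x) (hψ.differentiable x)]
  simp [mul_comm]

theorem fderiv_sub (hφ : IsTest Ω φ) (hψ : IsTest Ω ψ) (x v : E d) :
    fderiv ℝ (fun x => φ x - ψ x) x v = fderiv ℝ φ x v - fderiv ℝ ψ x v := by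
  rw [fderiv_fun_sub (hφ.differentiable x) (hψ.differentiable x)]
  simp

theorem support_fderiv_subset (hφ : IsTest Ω φ) : Function.support (fderiv ℝ φ) ⊆ Ω :=
  fun _ hx => hφ.2.2 (tsupport_fderiv_subset ℝ (subset_tsupport _ hx))

theorem integrable_mul (hφ : IsTest Ω φ) {g : E d → ℝ} (hg : LocallyIntegrableOn g Ω volume) :
    Integrable (fun x => g x * φ x) (vol Ω) := by
  have h1 : IntegrableOn g (tsupport φ) volume := hg.integrableOn_compact_subset hφ.2.2 hφ.2.1
  have h2 : IntegrableOn (fun x => g x * φ x) (tsupport φ) volume :=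
    h1.mul_continuousOn hφ.1.continuous.continuousOn hφ.2.1
  rw [integrableOn_iff_integrable_of_support_subset] at h2
  · exact h2.restrict
  · intro x hx
    refine subset_tsupport φ fun h => hx ?_
    simp only [h, mul_zero]

end IsTest

/-! ### Weak derivatives -/

theorem _root_.MeasureTheory.MemLp.locallyIntegrableOn_of_isBounded (hb : Bornology.IsBounded Ω)
    {g : E d → ℝ} {p : ℝ≥0∞} (hp : 1 ≤ p) (hg : MemLp g p (vol Ω)) :
    LocallyIntegrableOn g Ω volume := by
  have : IsFiniteMeasure (vol Ω) := ⟨by simpa using hb.measure_lt_top⟩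
  exact IntegrableOn.locallyIntegrableOn (hg.integrable hp)

namespace IsWeakDeriv

variable {j : Fin d} {g g' h h' : E d → ℝ}

/-- The fundamental lemma of the calculus of variations: the difference of the two derivatives
integrates to zero against every test function. -/
theorem ae_eq (hΩ : IsOpen Ω) (hg : IsWeakDeriv Ω j g g') (hh : IsWeakDeriv Ω j h h')
    (hgh : g =ᵐ[vol Ω] h) : g' =ᵐ[vol Ω] h' := by
  have key := hΩ.ae_eq_zero_of_integral_contDiff_smul_eq_zero (f := fun x => g' x - h' x)
    (μ := volume) (hg.2.1.sub hh.2.1) (fun φ h1 h2 h3 => by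
      have hφ : IsTest Ω φ := ⟨h1, h2, h3⟩
      have e : ∫ x in Ω, g x * fderiv ℝ φ x (stdVec j) = ∫ x in Ω, h x * fderiv ℝ φ x (stdVec j) :=
        integral_congr_ae (hgh.mono fun x hx => by simp only [hx])
      rw [hg.2.2 φ hφ, hh.2.2 φ hφ, neg_inj] at e
      rw [← setIntegral_eq_integral_of_forall_compl_eq_zero (s := Ω)
        (fun x hx => by simp [hφ.eq_zero_of_notMem hx])]
      have : ∀ x, φ x • (g' x - h' x) = g' x * φ x - h' x * φ x := fun x => by
        simp only [smul_eq_mul]; ring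
      simp_rw [this]
      rw [integral_sub (hφ.integrable_mul hg.2.1) (hφ.integrable_mul hh.2.1), e, sub_self])
  rw [Filter.EventuallyEq, ae_restrict_iff' hΩ.measurableSet]
  exact key.mono fun x hx hxΩ => sub_eq_zero.1 (hx hxΩ)

theorem sub (hg : IsWeakDeriv Ω j g g') (hh : IsWeakDeriv Ω j h h') :
    IsWeakDeriv Ω j (fun x => g x - h x) (fun x => g' x - h' x) := by
  refine ⟨hg.1.sub hh.1, hg.2.1.sub hh.2.1, fun φ hφ => ?_⟩
  simp_rw [sub_mul]
  rw [integral_sub ((hφ.fderiv_apply _).integrable_mul hg.1)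
      ((hφ.fderiv_apply _).integrable_mul hh.1),
    integral_sub (hφ.integrable_mul hg.2.1) (hφ.integrable_mul hh.2.1), hg.2.2 φ hφ, hh.2.2 φ hφ]
  ring

/-- `weakDeriv` is an arbitrary choice among the weak derivatives; this lets an explicitly computed
one replace it almost everywhere. -/
theorem weakDeriv_ae_eq (hΩ : IsOpen Ω) (hg : IsWeakDeriv Ω j g g') :
    weakDeriv Ω j g =ᵐ[vol Ω] g' := by
  have hex : ∃ g', IsWeakDeriv Ω j g g' := ⟨g', hg⟩
  rw [weakDeriv, dif_pos hex]
  exact hex.choose_spec.ae_eq hΩ hg .rfl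

theorem isWeakDeriv_weakDeriv (hg : IsWeakDeriv Ω j g g') :
    IsWeakDeriv Ω j g (weakDeriv Ω j g) := by
  have hex : ∃ g', IsWeakDeriv Ω j g g' := ⟨g', hg⟩
  rw [weakDeriv, dif_pos hex]
  exact hex.choose_spec

end IsWeakDeriv

namespace MemW1

variable {p : ℝ≥0∞} {g : E d → ℝ}

theorem isWeakDeriv (hg : MemW1 Ω p g) (j : Fin d) : IsWeakDeriv Ω j g (weakDeriv Ω j g) := by
  obtain ⟨g', h, -⟩ := hg.2 j
  exact h.isWeakDeriv_weakDeriv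

theorem memLp_weakDeriv (hΩ : IsOpen Ω) (hg : MemW1 Ω p g) (j : Fin d) :
    MemLp (weakDeriv Ω j g) p (vol Ω) := by
  obtain ⟨g', h, h'⟩ := hg.2 j
  exact (memLp_congr_ae (h.weakDeriv_ae_eq hΩ)).2 h'

end MemW1

/-! ### The Sobolev inequality for `H¹₀` -/

theorem norm_le_sum_stdVec (L : E d →L[ℝ] ℝ) : ‖L‖ ≤ ∑ j, ‖L (stdVec j)‖ := by
  refine L.opNorm_le_bound (by positivity) fun x => ?_
  have hx : x = ∑ j, x j • (stdVec j : E d) := by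
    ext i
    simp [Finset.sum_apply, stdVec, Pi.single_apply]
  calc ‖L x‖ = ‖∑ j, x j * L (stdVec j)‖ := by
        conv_lhs => rw [hx]
        simp only [map_sum, map_smul, smul_eq_mul]
    _ ≤ ∑ j, ‖x j * L (stdVec j)‖ := norm_sum_le _ _
    _ ≤ ∑ j, ‖L (stdVec j)‖ * ‖x‖ := by
        refine Finset.sum_le_sum fun j _ => ?_
        rw [norm_mul, mul_comm]
        gcongr
        exact PiLp.norm_apply_le x j
    _ = _ := by rw [Finset.sum_mul]

/-- Gagliardo–Nirenberg–Sobolev with a gradient exponent `p < d`, followed by Hölder on the bounded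
domain to raise `p` to `2`. -/
theorem exists_lpNorm_four_le_of_isTest (hd : d = 2 ∨ d = 3) (hb : Bornology.IsBounded Ω) :
    ∃ C : ℝ, 0 ≤ C ∧ ∀ φ : E d → ℝ, IsTest Ω φ →
      lpNorm φ 4 (vol Ω) ≤ C * ∑ j, lpNorm (fun x => fderiv ℝ φ x (stdVec j)) 2 (vol Ω) := by
  have hfin : IsFiniteMeasure (vol Ω) := ⟨by simpa using hb.measure_lt_top⟩
  obtain ⟨p, hp1, hpd, hp4, hp2⟩ : ∃ p : ℝ≥0, 1 ≤ p ∧ p < (d : ℝ≥0) ∧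
      (p : ℝ)⁻¹ - (d : ℝ)⁻¹ ≤ ((4 : ℝ≥0) : ℝ)⁻¹ ∧ p ≤ 2 := by
    -- In dimension two `p = 2` is excluded by `p < d`; `p = 4/3` has Sobolev exponent exactly `4`.
    -- In dimension three `p = 2` has Sobolev exponent `6`, more than needed.
    rcases hd with rfl | rfl
    · refine ⟨4 / 3, ?_, ?_, ?_, ?_⟩
      · rw [← NNReal.coe_le_coe]; norm_num
      · rw [← NNReal.coe_lt_coe]; norm_num
      · norm_num
      · rw [← NNReal.coe_le_coe]; norm_num
    · refine ⟨2, ?_, ?_, ?_, le_rfl⟩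
      · rw [← NNReal.coe_le_coe]; norm_num
      · rw [← NNReal.coe_lt_coe]; norm_num
      · norm_num
  set K := eLpNormLESNormFDerivOfLeConst ℝ (volume : Measure (E d)) Ω p 4
  set m := vol Ω Set.univ ^ (1 / (p : ℝ≥0∞).toReal - 1 / (2 : ℝ≥0∞).toReal)
  have hm : m ≠ ⊤ := by
    refine ENNReal.rpow_ne_top_of_nonneg ?_ (measure_ne_top _ _)
    rw [sub_nonneg]
    have : (0 : ℝ) < p := by exact_mod_cast (zero_lt_one.trans_le hp1)
    simp only [ENNReal.coe_toReal, ENNReal.toReal_ofNat]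
    exact one_div_le_one_div_of_le this (by exact_mod_cast hp2)
  refine ⟨(K * m).toReal, by positivity, fun φ hφ => ?_⟩
  have hcont : Continuous (fderiv ℝ φ) := hφ.1.continuous_fderiv (by simp)
  have hsupp : Function.support φ ⊆ Ω := (subset_tsupport φ).trans hφ.2.2
  have h1 : eLpNorm φ 4 (vol Ω) ≤ K * eLpNorm (fderiv ℝ φ) p (vol Ω) := by
    have h := eLpNorm_le_eLpNorm_fderiv_of_le (volume : Measure (E d)) (hφ.1.of_le (by simp))
      hsupp hp1 (q := 4) (by simpa using hpd) (by simpa using hp4) hb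
    have h4 : eLpNorm φ 4 (vol Ω) ≤ eLpNorm φ ((4 : ℝ≥0) : ℝ≥0∞) volume := by
      simpa using eLpNorm_mono_measure φ Measure.restrict_le_self
    rw [← eLpNorm_restrict_eq_of_support_subset (f := fderiv ℝ φ)
      hφ.support_fderiv_subset] at h
    exact h4.trans h
  have h2 : eLpNorm (fderiv ℝ φ) p (vol Ω) ≤
      (∑ j, eLpNorm (fun x => fderiv ℝ φ x (stdVec j)) 2 (vol Ω)) * m := by
    calc eLpNorm (fderiv ℝ φ) p (vol Ω)
        ≤ eLpNorm (fderiv ℝ φ) 2 (vol Ω) * m :=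
          eLpNorm_le_eLpNorm_mul_rpow_measure_univ (by exact_mod_cast hp2)
            hcont.aestronglyMeasurable
      _ ≤ eLpNorm (∑ j, fun x => ‖fderiv ℝ φ x (stdVec j)‖) 2 (vol Ω) * m := by
          gcongr
          refine eLpNorm_mono_real fun x => ?_
          simpa using norm_le_sum_stdVec (fderiv ℝ φ x)
      _ ≤ (∑ j, eLpNorm (fun x => ‖fderiv ℝ φ x (stdVec j)‖) 2 (vol Ω)) * m := by
          gcongr
          exact eLpNorm_sum_le
            (fun j _ => ((hφ.fderiv_apply _).1.continuous.norm).aestronglyMeasurable) (by norm_num)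
      _ = _ := by simp only [eLpNorm_norm]
  have hj : ∀ j, eLpNorm (fun x => fderiv ℝ φ x (stdVec j)) 2 (vol Ω) ≠ ⊤ :=
    fun j => ((hφ.fderiv_apply _).memLp 2).2.ne
  have h3 := ENNReal.toReal_mono (by
    refine ENNReal.mul_ne_top ENNReal.coe_ne_top (ENNReal.mul_ne_top ?_ hm)
    exact ENNReal.sum_ne_top.2 fun j _ => hj j) (h1.trans (mul_le_mul_right h2 (K : ℝ≥0∞)))
  rw [toReal_eLpNorm (hφ.memLp 4).1, ENNReal.toReal_mul, ENNReal.toReal_mul,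
    ENNReal.toReal_sum fun j _ => hj j] at h3
  rw [ENNReal.toReal_mul]
  refine h3.trans (le_of_eq ?_)
  have h5 : ∀ j, (eLpNorm (fun x => fderiv ℝ φ x (stdVec j)) 2 (vol Ω)).toReal =
      lpNorm (fun x => fderiv ℝ φ x (stdVec j)) 2 (vol Ω) :=
    fun j => toReal_eLpNorm ((hφ.fderiv_apply (stdVec j)).memLp 2).1
  simp_rw [h5]
  ring

theorem isFiniteMeasure_vol (hb : Bornology.IsBounded Ω) : IsFiniteMeasure (vol Ω) :=
  ⟨by simpa using hb.measure_lt_top⟩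

namespace MemH10

variable {v w : E d → ℝ}

/-- By the Sobolev inequality, test functions that approximate `v` in `H¹` are Cauchy in `L⁴`;
Fatou's lemma identifies their `L⁴` limit with `v`. -/
theorem memLp_four_and_exists_isTest (hd : d = 2 ∨ d = 3) (hΩ : IsOpen Ω)
    (hb : Bornology.IsBounded Ω) (hv : MemH10 Ω v) :
    MemLp v 4 (vol Ω) ∧ ∀ ε : ℝ, 0 < ε → ∃ φ : E d → ℝ, IsTest Ω φ ∧
      lpNorm (fun x => v x - φ x) 4 (vol Ω) < ε ∧
      ∀ j, lpNorm (fun x => weakDeriv Ω j v x - fderiv ℝ φ x (stdVec j)) 2 (vol Ω) < ε := by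
  obtain ⟨C, hC, hS⟩ := exists_lpNorm_four_le_of_isTest hd hb
  have hε : ∀ k : ℕ, (0 : ℝ) < 1 / ((k : ℝ) + 1) := fun k => by positivity
  choose φ hφ hφ2 hφd using fun k : ℕ => hv.2 _ (hε k)
  have hdv : ∀ j, MemLp (weakDeriv Ω j v) 2 (vol Ω) := hv.1.memLp_weakDeriv hΩ
  have hdiff : ∀ k l : ℕ, k ≤ l →
      lpNorm (fun x => φ l x - φ k x) 4 (vol Ω) ≤ C * (d * (2 * (1 / ((k : ℝ) + 1)))) := by
    intro k l hkl
    refine (hS _ ((hφ l).sub (hφ k))).trans (mul_le_mul_of_nonneg_left ?_ hC)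
    calc ∑ j, lpNorm (fun x => fderiv ℝ (fun x => φ l x - φ k x) x (stdVec j)) 2 (vol Ω)
        ≤ ∑ _j : Fin d, 2 * (1 / ((k : ℝ) + 1)) := by
          refine Finset.sum_le_sum fun j _ => ?_
          have hfun : (fun x => fderiv ℝ (fun x => φ l x - φ k x) x (stdVec j)) =
              (fun x => weakDeriv Ω j v x - fderiv ℝ (φ k) x (stdVec j)) -
              (fun x => weakDeriv Ω j v x - fderiv ℝ (φ l) x (stdVec j)) := by
            ext x
            rw [(hφ l).fderiv_sub (hφ k), Pi.sub_apply]
            ring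
          rw [hfun]
          have h1 : (1 : ℝ) / (l + 1) ≤ 1 / (k + 1) := by
            have : (k : ℝ) ≤ l := by exact_mod_cast hkl
            gcongr
          refine (lpNorm_sub_le (f := fun x => weakDeriv Ω j v x - fderiv ℝ (φ k) x (stdVec j))
            ((hdv j).sub (((hφ k).fderiv_apply _).memLp 2)) (by norm_num)).trans ?_
          linarith [hφd k j, hφd l j]
      _ = _ := by simp
  -- The `L²` convergence is used only to extract a subsequence converging to `v` almost everywhere.
  have hmeas : TendstoInMeasure (vol Ω) φ Filter.atTop v := by
    refine tendstoInMeasure_of_tendsto_eLpNorm (p := 2) (by norm_num)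
      (fun k => ((hφ k).memLp 2).1) hv.1.1.1 ?_
    have h0 : Filter.Tendsto (fun k : ℕ => ENNReal.ofReal (1 / ((k : ℝ) + 1))) Filter.atTop
        (nhds 0) := by
      simpa using ENNReal.tendsto_ofReal tendsto_one_div_add_atTop_nhds_zero_nat
    refine tendsto_of_tendsto_of_tendsto_of_le_of_le tendsto_const_nhds h0
      (fun _ => zero_le) fun k => ?_
    have hm : MemLp (fun x => v x - φ k x) 2 (vol Ω) := hv.1.1.sub ((hφ k).memLp 2)
    have h2 := (hφ2 k).le
    rw [← toReal_eLpNorm hm.1] at h2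
    simp only [eLpNorm_sub_comm (φ k) v]
    exact (ENNReal.le_ofReal_iff_toReal_le hm.2.ne (hε k).le).2 h2
  obtain ⟨ns, hns, hlim⟩ := hmeas.exists_seq_tendsto_ae
  have hbound : ∀ k : ℕ, eLpNorm (fun x => v x - φ k x) 4 (vol Ω) ≤
      ENNReal.ofReal (C * (d * (2 * (1 / ((k : ℝ) + 1))))) := by
    intro k
    -- Fatou in the subsequence index with `k` fixed. The Cauchy bound `hdiff` applies once that
    -- index exceeds `k`, hence the `max N k` below.
    have hl := Lp.eLpNorm_lim_le_liminf_eLpNorm (p := 4) (μ := vol Ω)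
      (f := fun i x => φ (ns i) x - φ k x)
      (fun i => (((hφ (ns i)).sub (hφ k)).memLp 4).1) (fun x => v x - φ k x)
      (hlim.mono fun x hx => hx.sub_const _)
    refine hl.trans (Filter.liminf_le_of_le (by isBoundedDefault) fun b hb => ?_)
    obtain ⟨N, hN⟩ := Filter.eventually_atTop.1 hb
    refine (hN (max N k) (le_max_left _ _)).trans ?_
    have hm := ((hφ (ns (max N k))).sub (hφ k)).memLp 4
    rw [ENNReal.le_ofReal_iff_toReal_le hm.2.ne (by positivity), toReal_eLpNorm hm.1]
    exact hdiff k _ ((le_max_right _ _).trans (hns.id_le _))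
  have hmem : ∀ k, MemLp (fun x => v x - φ k x) 4 (vol Ω) := fun k =>
    ⟨hv.1.1.1.sub ((hφ k).memLp 4).1, (hbound k).trans_lt ENNReal.ofReal_lt_top⟩
  refine ⟨?_, fun ε hε0 => ?_⟩
  · have h := (hmem 0).add ((hφ 0).memLp 4)
    have e : (fun x => v x - φ 0 x) + φ 0 = v := by ext x; simp
    rwa [e] at h
  have hto : Filter.Tendsto (fun k : ℕ => C * (d * (2 * (1 / ((k : ℝ) + 1))))) Filter.atTop
      (nhds 0) := by
    simpa using ((tendsto_one_div_add_atTop_nhds_zero_nat (𝕜 := ℝ)).const_mul 2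
      |>.const_mul (d : ℝ) |>.const_mul C)
  obtain ⟨k, hk1, hk2⟩ := ((hto.eventually (gt_mem_nhds hε0)).and
    (tendsto_one_div_add_atTop_nhds_zero_nat.eventually (gt_mem_nhds hε0))).exists
  refine ⟨φ k, hφ k, ?_, fun j => (hφd k j).trans hk2⟩
  rw [← toReal_eLpNorm (hmem k).1]
  exact (ENNReal.toReal_le_of_le_ofReal (by positivity) (hbound k)).trans_lt hk1

theorem memLp_four (hd : d = 2 ∨ d = 3) (hΩ : IsOpen Ω) (hb : Bornology.IsBounded Ω)
    (hv : MemH10 Ω v) : MemLp v 4 (vol Ω) :=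
  (hv.memLp_four_and_exists_isTest hd hΩ hb).1

/-- A linear identity that holds for all test functions holds on `H¹₀`. -/
theorem integral_eq_zero_of_forall_isTest (hd : d = 2 ∨ d = 3) (hΩ : IsOpen Ω)
    (hb : Bornology.IsBounded Ω) (hv : MemH10 Ω v) {A : E d → ℝ} {B : Fin d → E d → ℝ}
    (hA : MemLp A (4 / 3) (vol Ω)) (hB : ∀ j, MemLp (B j) 2 (vol Ω))
    (h : ∀ φ, IsTest Ω φ →
      ∫ x in Ω, (A x * φ x + ∑ j, B j x * fderiv ℝ φ x (stdVec j)) = 0) :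
    ∫ x in Ω, (A x * v x + ∑ j, B j x * weakDeriv Ω j v x) = 0 := by
  obtain ⟨hv4, happ⟩ := hv.memLp_four_and_exists_isTest hd hΩ hb
  have hdv := hv.1.memLp_weakDeriv hΩ
  set K := lpNorm A (4 / 3) (vol Ω) + ∑ j, lpNorm (B j) 2 (vol Ω)
  have hK : 0 ≤ K := add_nonneg lpNorm_nonneg (Finset.sum_nonneg fun _ _ => lpNorm_nonneg)
  have key : ∀ ε : ℝ, 0 < ε →
      |∫ x in Ω, (A x * v x + ∑ j, B j x * weakDeriv Ω j v x)| ≤ K * ε := by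
    intro ε hε
    obtain ⟨φ, hφ, h4, h2⟩ := happ ε hε
    have e1 : Integrable (fun x => A x * v x + ∑ j, B j x * weakDeriv Ω j v x) (vol Ω) :=
      (integrable_mul_four_thirds hA hv4).add
        (integrable_finsetSum _ fun j _ => integrable_mul_two (hB j) (hdv j))
    have e2 : Integrable (fun x => A x * φ x + ∑ j, B j x * fderiv ℝ φ x (stdVec j)) (vol Ω) :=
      (integrable_mul_four_thirds hA (hφ.memLp 4)).add
        (integrable_finsetSum _ fun j _ =>
          integrable_mul_two (hB j) ((hφ.fderiv_apply _).memLp 2))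
    -- Subtracting the vanishing integral for `φ` leaves only the differences `v - φ` and their
    -- derivatives, which Hölder bounds by `K * ε`.
    have e3 : ∫ x in Ω, (A x * v x + ∑ j, B j x * weakDeriv Ω j v x) =
        ∫ x in Ω, A x * (v x - φ x) +
          ∑ j, B j x * (weakDeriv Ω j v x - fderiv ℝ φ x (stdVec j)) := by
      rw [← sub_zero (∫ x in Ω, (A x * v x + ∑ j, B j x * weakDeriv Ω j v x)), ← h φ hφ,
        ← integral_sub e1 e2]
      refine integral_congr_ae (.of_forall fun x => ?_)
      simp only [mul_sub, Finset.sum_sub_distrib]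
      ring
    have m1 : MemLp (fun x => v x - φ x) 4 (vol Ω) := hv4.sub (hφ.memLp 4)
    have m2 : ∀ j, MemLp (fun x => weakDeriv Ω j v x - fderiv ℝ φ x (stdVec j)) 2 (vol Ω) :=
      fun j => (hdv j).sub ((hφ.fderiv_apply _).memLp 2)
    rw [e3, integral_add (integrable_mul_four_thirds hA m1)
      (integrable_finsetSum _ fun j _ => integrable_mul_two (hB j) (m2 j)),
      integral_finsetSum _ fun j _ => integrable_mul_two (hB j) (m2 j)]
    refine (abs_add_le _ _).trans ?_
    rw [add_mul, Finset.sum_mul]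
    refine add_le_add ?_ ((Finset.abs_sum_le_sum_abs _ _).trans (Finset.sum_le_sum fun j _ => ?_))
    · refine (abs_integral_mul_le_lpNorm holderTriple_four_thirds_four hA m1).trans ?_
      exact mul_le_mul_of_nonneg_left h4.le lpNorm_nonneg
    · refine (abs_integral_mul_le_lpNorm inferInstance (hB j) (m2 j)).trans ?_
      exact mul_le_mul_of_nonneg_left (h2 j).le lpNorm_nonneg
  refine abs_nonpos_iff.1 (le_of_forall_pos_le_add fun δ hδ => ?_)
  refine (key (δ / (K + 1)) (by positivity)).trans ?_
  rw [zero_add, mul_div_assoc', div_le_iff₀ (by positivity)]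
  nlinarith

/-- Poincaré's inequality as a consequence of the Sobolev inequality: finite measure gives `L² ≤
L⁴`, and the bound passes from test functions to `H¹₀` by density. -/
theorem exists_lpNorm_two_le (hd : d = 2 ∨ d = 3) (hΩ : IsOpen Ω) (hb : Bornology.IsBounded Ω) :
    ∃ C : ℝ, 0 ≤ C ∧ ∀ v : E d → ℝ, MemH10 Ω v →
      lpNorm v 2 (vol Ω) ≤ C * ∑ j, lpNorm (weakDeriv Ω j v) 2 (vol Ω) := by
  have hfin := isFiniteMeasure_vol hb
  obtain ⟨C, hC, hS⟩ := exists_lpNorm_four_le_of_isTest hd hb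
  set m := vol Ω Set.univ ^ (1 / (2 : ℝ≥0∞).toReal - 1 / (4 : ℝ≥0∞).toReal)
  have hm : m ≠ ⊤ := by
    refine ENNReal.rpow_ne_top_of_nonneg ?_ (measure_ne_top _ _)
    norm_num
  refine ⟨m.toReal * C, by positivity, fun v hv => ?_⟩
  have hdv := hv.1.memLp_weakDeriv hΩ
  obtain ⟨hv4, happ⟩ := hv.memLp_four_and_exists_isTest hd hΩ hb
  have h1 : lpNorm v 2 (vol Ω) ≤ m.toReal * lpNorm v 4 (vol Ω) := by
    have h := eLpNorm_le_eLpNorm_mul_rpow_measure_univ (p := 2) (q := 4) (μ := vol Ω)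
      (by norm_num) hv4.1
    have h' := ENNReal.toReal_mono (ENNReal.mul_ne_top hv4.2.ne hm) h
    rwa [ENNReal.toReal_mul, toReal_eLpNorm hv4.1, toReal_eLpNorm hv4.1, mul_comm] at h'
  rw [mul_assoc]
  refine h1.trans (mul_le_mul_of_nonneg_left ?_ ENNReal.toReal_nonneg)
  refine le_of_forall_pos_le_add fun δ hδ => ?_
  set ε := δ / (1 + C * d)
  have hε : 0 < ε := by positivity
  obtain ⟨φ, hφ, h4, h2⟩ := happ ε hε
  have t1 : lpNorm v 4 (vol Ω) ≤ lpNorm (fun x => v x - φ x) 4 (vol Ω) + lpNorm φ 4 (vol Ω) := by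
    have := lpNorm_add_le (f := fun x => v x - φ x) (g := φ) (hv4.sub (hφ.memLp 4)) (by norm_num)
    have e : (fun x => v x - φ x) + φ = v := by ext x; simp
    rwa [e] at this
  have t2 : ∀ j, lpNorm (fun x => fderiv ℝ φ x (stdVec j)) 2 (vol Ω) ≤
      lpNorm (weakDeriv Ω j v) 2 (vol Ω) + ε := by
    intro j
    have := lpNorm_sub_le (f := weakDeriv Ω j v)
      (g := fun x => weakDeriv Ω j v x - fderiv ℝ φ x (stdVec j)) (hdv j) (by norm_num : (1 : ℝ≥0∞) ≤ 2)
    have e : weakDeriv Ω j v - (fun x => weakDeriv Ω j v x - fderiv ℝ φ x (stdVec j)) =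
      fun x => fderiv ℝ φ x (stdVec j) := by ext x; simp
    rw [e] at this
    linarith [h2 j]
  have t3 : C * ∑ j, lpNorm (fun x => fderiv ℝ φ x (stdVec j)) 2 (vol Ω) ≤
      C * (∑ j, lpNorm (weakDeriv Ω j v) 2 (vol Ω) + d * ε) := by
    refine mul_le_mul_of_nonneg_left ?_ hC
    refine (Finset.sum_le_sum fun j _ => t2 j).trans (le_of_eq ?_)
    simp [Finset.sum_add_distrib]
  have t4 : ε * (1 + C * d) = δ := div_mul_cancel₀ _ (by positivity)
  nlinarith [hS φ hφ]

end MemH10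

/-! ### Products and integration by parts with `H¹₀` factors -/

theorem memLp_four_thirds_of_two (hb : Bornology.IsBounded Ω) {g : E d → ℝ}
    (hg : MemLp g 2 (vol Ω)) : MemLp g (4 / 3) (vol Ω) := by
  have hfin := isFiniteMeasure_vol hb
  refine hg.mono_exponent ?_
  refine ENNReal.div_le_of_le_mul ?_
  norm_num

theorem memLp_two_of_four (hb : Bornology.IsBounded Ω) {g : E d → ℝ}
    (hg : MemLp g 4 (vol Ω)) : MemLp g 2 (vol Ω) := by
  have hfin := isFiniteMeasure_vol hb
  exact hg.mono_exponent (by norm_num)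

/-- For a smooth `φ` in place of `w`, this is the weak derivative of `ρ` tested with `φψ`. That
identity is linear in `φ`, so it extends to `H¹₀`. -/
theorem IsWeakDeriv.mul_of_memW1_of_memH10 (hd : d = 2 ∨ d = 3) (hΩ : IsOpen Ω)
    (hb : Bornology.IsBounded Ω) {ρ w : E d → ℝ} (hρ : MemW1 Ω ∞ ρ)
    (hw : MemH10 Ω w) (j : Fin d) :
    IsWeakDeriv Ω j (fun x => ρ x * w x)
      (fun x => ρ x * weakDeriv Ω j w x + weakDeriv Ω j ρ x * w x) := by
  have hρ' := hρ.memLp_weakDeriv hΩ j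
  have hw' := hw.1.memLp_weakDeriv hΩ j
  have m1 : MemLp (fun x => ρ x * w x) 2 (vol Ω) := memLp_mul_of_top hρ.1 hw.1.1
  have m2 : MemLp (fun x => ρ x * weakDeriv Ω j w x + weakDeriv Ω j ρ x * w x) 2 (vol Ω) :=
    (memLp_mul_of_top hρ.1 hw').add (memLp_mul_of_top hρ' hw.1.1)
  refine ⟨m1.locallyIntegrableOn_of_isBounded hb (by norm_num),
    m2.locallyIntegrableOn_of_isBounded hb (by norm_num), fun ψ hψ => ?_⟩
  have hψ' := hψ.fderiv_apply (stdVec j)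
  have key := hw.integral_eq_zero_of_forall_isTest hd hΩ hb
    (A := fun x => ρ x * fderiv ℝ ψ x (stdVec j) + weakDeriv Ω j ρ x * ψ x)
    (B := fun i x => if i = j then ρ x * ψ x else 0)
    (memLp_four_thirds_of_two hb
      ((memLp_mul_of_top hρ.1 (hψ'.memLp 2)).add (memLp_mul_of_top hρ' (hψ.memLp 2))))
    (fun i => by
      by_cases h : i = j
      · simpa [h] using memLp_mul_of_top hρ.1 (hψ.memLp 2)
      · simp [h])
    (fun φ hφ => by
      have h := (hρ.isWeakDeriv j).2.2 _ (hφ.mul hψ)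
      simp_rw [hφ.fderiv_mul hψ] at h
      rw [eq_neg_iff_add_eq_zero, ← integral_add] at h
      · refine Eq.trans ?_ h
        refine integral_congr_ae (.of_forall fun x => ?_)
        simp only [ite_mul, zero_mul, Finset.sum_ite_eq', Finset.mem_univ, if_true]
        ring
      · have hi := ((hφ.mul hψ).fderiv_apply (stdVec j)).integrable_mul (hρ.isWeakDeriv j).1
        simpa only [hφ.fderiv_mul hψ] using hi
      · exact (hφ.mul hψ).integrable_mul (hρ.isWeakDeriv j).2.1)
  rw [eq_neg_iff_add_eq_zero, ← integral_add (integrable_mul_two m1 (hψ'.memLp 2))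
    (integrable_mul_two m2 (hψ.memLp 2)), ← key]
  refine integral_congr_ae (.of_forall fun x => ?_)
  simp only [ite_mul, zero_mul, Finset.sum_ite_eq', Finset.mem_univ, if_true]
  ring

/-- The mixed derivatives of two `H¹₀` functions can be exchanged under the integral. -/
theorem integral_weakDeriv_mul_weakDeriv_comm (hd : d = 2 ∨ d = 3) (hΩ : IsOpen Ω)
    (hb : Bornology.IsBounded Ω) {v w : E d → ℝ} (hv : MemH10 Ω v)
    (hw : MemH10 Ω w) (i j : Fin d) :
    ∫ x in Ω, weakDeriv Ω i v x * weakDeriv Ω j w x =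
      ∫ x in Ω, weakDeriv Ω j v x * weakDeriv Ω i w x := by
  have hv' := hv.1.memLp_weakDeriv hΩ
  have hw' := hw.1.memLp_weakDeriv hΩ
  -- Only one function is replaced by a smooth one. Then both derivatives of `v` are moved onto it,
  -- where second derivatives commute.
  have swap : ∀ φ : E d → ℝ, IsTest Ω φ → ∀ x,
      fderiv ℝ (fun y => fderiv ℝ φ y (stdVec j)) x (stdVec i) =
      fderiv ℝ (fun y => fderiv ℝ φ y (stdVec i)) x (stdVec j) := by
    intro φ hφ x
    have hdf : DifferentiableAt ℝ (fderiv ℝ φ) x :=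
      ((hφ.1.fderiv_right (m := 1) (by norm_cast)).differentiable (by simp)) x
    have hsymm : IsSymmSndFDerivAt ℝ φ x :=
      (hφ.1.contDiffAt).isSymmSndFDerivAt (by simp; norm_cast)
    have e : ∀ a b : E d, fderiv ℝ (fun y => fderiv ℝ φ y a) x b =
        fderiv ℝ (fderiv ℝ φ) x b a := fun a b => by
      rw [fderiv_clm_apply hdf (differentiableAt_const _)]
      simp
    rw [e, e]
    exact hsymm _ _
  have key := hw.integral_eq_zero_of_forall_isTest hd hΩ hb (A := fun _ => 0)
    (B := fun k x => (if k = j then weakDeriv Ω i v x else 0) -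
      (if k = i then weakDeriv Ω j v x else 0)) (by simp)
    (fun k => by
      refine MemLp.sub ?_ ?_
      · by_cases h : k = j
        · simpa [h] using hv' i
        · simp [h]
      · by_cases h : k = i
        · simpa [h] using hv' j
        · simp [h])
    (fun φ hφ => by
      have h1 := (hv.1.isWeakDeriv i).2.2 _ (hφ.fderiv_apply (stdVec j))
      have h2 := (hv.1.isWeakDeriv j).2.2 _ (hφ.fderiv_apply (stdVec i))
      simp_rw [swap φ hφ] at h1
      rw [h1, neg_inj, ← sub_eq_zero, ← integral_sub
        (integrable_mul_two (hv' i) ((hφ.fderiv_apply _).memLp 2))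
        (integrable_mul_two (hv' j) ((hφ.fderiv_apply _).memLp 2))] at h2
      refine Eq.trans ?_ h2
      refine integral_congr_ae (.of_forall fun x => ?_)
      simp [sub_mul, Finset.sum_sub_distrib])
  rw [← sub_eq_zero, ← integral_sub (integrable_mul_two (hv' i) (hw' j))
    (integrable_mul_two (hv' j) (hw' i)), ← key]
  refine integral_congr_ae (.of_forall fun x => ?_)
  simp [sub_mul, Finset.sum_sub_distrib]

/-- `∫ ∂_j(ρ w v²) = 0`, with the derivative expanded. -/
theorem integral_weakDeriv_mul_mul_sq_eq_zero (hd : d = 2 ∨ d = 3) (hΩ : IsOpen Ω)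
    (hb : Bornology.IsBounded Ω) {ρ v w : E d → ℝ} (hρ : MemW1 Ω ∞ ρ)
    (hv : MemH10 Ω v) (hw : MemH10 Ω w) (j : Fin d) :
    ∫ x in Ω, (2 * (ρ x * w x * v x * weakDeriv Ω j v x) +
      (ρ x * weakDeriv Ω j w x + weakDeriv Ω j ρ x * w x) * v x ^ 2) = 0 := by
  have hv' := hv.1.memLp_weakDeriv hΩ j
  have hw' := hw.1.memLp_weakDeriv hΩ j
  have hρ' := hρ.memLp_weakDeriv hΩ j
  have hv4 := hv.memLp_four hd hΩ hb
  have hw4 := hw.memLp_four hd hΩ hb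
  have m1 : MemLp (fun x => ρ x * w x) 4 (vol Ω) := memLp_mul_of_top hρ.1 hw4
  have m2 : MemLp (fun x => ρ x * weakDeriv Ω j w x + weakDeriv Ω j ρ x * w x) 2 (vol Ω) :=
    (memLp_mul_of_top hρ.1 hw').add (memLp_mul_of_top hρ' hw.1.1)
  have hprod := IsWeakDeriv.mul_of_memW1_of_memH10 hd hΩ hb hρ hw j
  -- The target is quadratic in `v`, while the density argument is linear. Here one factor `v` is
  -- reached from test functions and the other is still the test function `ψ`.
  have htest : ∀ ψ, IsTest Ω ψ → ∫ x in Ω,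
      (ρ x * w x * (v x * fderiv ℝ ψ x (stdVec j) + weakDeriv Ω j v x * ψ x) +
      (ρ x * weakDeriv Ω j w x + weakDeriv Ω j ρ x * w x) * (v x * ψ x)) = 0 := by
    intro ψ hψ
    have hψ' := hψ.fderiv_apply (stdVec j)
    have key := hv.integral_eq_zero_of_forall_isTest hd hΩ hb
      (A := fun x => ρ x * w x * fderiv ℝ ψ x (stdVec j) +
        (ρ x * weakDeriv Ω j w x + weakDeriv Ω j ρ x * w x) * ψ x)
      (B := fun i x => if i = j then ρ x * w x * ψ x else 0)
      (memLp_four_thirds_of_two hb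
        ((memLp_mul_of_holder holderTriple_four_four_two m1 (hψ'.memLp 4)).add
          (memLp_mul_of_holder (p := 2) (q := ∞) inferInstance m2 (hψ.memLp ∞))))
      (fun i => by
        by_cases h : i = j
        · simpa [h] using memLp_mul_of_holder holderTriple_four_four_two m1 (hψ.memLp 4)
        · simp [h])
      (fun φ hφ => by
        have h := hprod.2.2 _ (hφ.mul hψ)
        simp_rw [hφ.fderiv_mul hψ] at h
        rw [eq_neg_iff_add_eq_zero, ← integral_add] at h
        · refine Eq.trans ?_ h
          refine integral_congr_ae (.of_forall fun x => ?_)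
          simp only [ite_mul, zero_mul, Finset.sum_ite_eq', Finset.mem_univ, if_true]
          ring
        · have hi := ((hφ.mul hψ).fderiv_apply (stdVec j)).integrable_mul hprod.1
          simpa only [hφ.fderiv_mul hψ] using hi
        · exact (hφ.mul hψ).integrable_mul hprod.2.1)
    rw [← key]
    refine integral_congr_ae (.of_forall fun x => ?_)
    simp only [ite_mul, zero_mul, Finset.sum_ite_eq', Finset.mem_univ, if_true]
    ring
  have m3 : MemLp (fun x => ρ x * w x * v x) 2 (vol Ω) :=
    memLp_mul_of_holder holderTriple_four_four_two m1 hv4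
  -- The second passage, from `ψ` to `v`. The coefficient of the zeroth-order term is now only in
  -- `L^{4/3}`, as a product of `L⁴` and `L²` functions.
  have key := hv.integral_eq_zero_of_forall_isTest hd hΩ hb
    (A := fun x => ρ x * w x * weakDeriv Ω j v x +
      v x * (ρ x * weakDeriv Ω j w x + weakDeriv Ω j ρ x * w x))
    (B := fun i x => if i = j then ρ x * w x * v x else 0)
    ((memLp_mul_of_holder holderTriple_four_two m1 hv').add
      (memLp_mul_of_holder holderTriple_four_two hv4 m2))
    (fun i => by
      by_cases h : i = j
      · simpa [h] using m3
      · simp [h])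
    (fun φ hφ => by
      refine Eq.trans ?_ (htest φ hφ)
      refine integral_congr_ae (.of_forall fun x => ?_)
      simp only [ite_mul, zero_mul, Finset.sum_ite_eq', Finset.mem_univ, if_true]
      ring)
  rw [← key]
  refine integral_congr_ae (.of_forall fun x => ?_)
  simp only [ite_mul, zero_mul, Finset.sum_ite_eq', Finset.mem_univ, if_true]
  ring

/-! ### The essential range of a `W^{1,∞}` function on a connected set -/

open scoped Convolution in
/-- The mollification of a `W^{1,∞}` function satisfies the Lipschitz bound of that function. -/
theorem norm_fderiv_convolution_le (hΩ : IsOpen Ω) {g : E d → ℝ} (hg : MemW1 Ω ∞ g)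
    (hgi : Integrable g (vol Ω)) (φ : ContDiffBump (0 : E d)) {x : E d}
    (hx : Metric.closedBall x φ.rOut ⊆ Ω) :
    DifferentiableAt ℝ (φ.normed volume ⋆[ContinuousLinearMap.lsmul ℝ ℝ, volume]
        Ω.indicator g) x ∧
      ‖fderiv ℝ (φ.normed volume ⋆[ContinuousLinearMap.lsmul ℝ ℝ, volume] Ω.indicator g) x‖ ≤
        ∑ j, lpNorm (weakDeriv Ω j g) ∞ (vol Ω) := by
  set f := φ.normed volume
  set L := (ContinuousLinearMap.lsmul ℝ ℝ : ℝ →L[ℝ] ℝ →L[ℝ] ℝ)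
  have hf1 : ContDiff ℝ ∞ f := φ.contDiff_normed
  have hfc : HasCompactSupport f := φ.hasCompactSupport_normed
  have hloc : LocallyIntegrable (Ω.indicator g) volume :=
    ((integrable_indicator_iff hΩ.measurableSet).2 hgi).locallyIntegrable
  have hD := hfc.hasFDerivAt_convolution_right L.flip hloc (hf1.of_le (by simp)) x
  rw [convolution_flip] at hD
  refine ⟨hD.differentiableAt, ?_⟩
  rw [hD.fderiv]
  refine (norm_le_sum_stdVec _).trans (Finset.sum_le_sum fun j _ => ?_)
  rw [convolution_precompR_apply L.flip hloc (hfc.fderiv ℝ) (hf1.continuous_fderiv (by simp))]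
  -- Since the closed ball lies in `Ω`, the shifted kernel is an admissible test function, and the
  -- derivative on it moves onto `g`. Its mass is one, so averaging does not increase the bound.
  have hψ : IsTest Ω (fun y => f (x - y)) := by
    refine ⟨hf1.comp (contDiff_const.sub contDiff_id),
      hfc.comp_homeomorph (Homeomorph.subLeft x), ?_⟩
    refine (closure_minimal (fun y hy => ?_) Metric.isClosed_closedBall).trans hx
    have h1 : x - y ∈ Function.support f := hy
    rw [φ.support_normed_eq, mem_ball_zero_iff] at h1
    rw [Metric.mem_closedBall, dist_comm, dist_eq_norm]
    exact h1.le
  have hder : ∀ y, fderiv ℝ (fun y => f (x - y)) y (stdVec j) =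
      -(fderiv ℝ f (x - y) (stdVec j)) := by
    intro y
    have h1 : HasFDerivAt f (fderiv ℝ f (x - y)) (x - y) :=
      (hf1.differentiable (by simp) _).hasFDerivAt
    have h2 : HasFDerivAt (fun y : E d => x - y) (-(ContinuousLinearMap.id ℝ (E d))) y :=
      (hasFDerivAt_id y).const_sub x
    have h3 : HasFDerivAt (fun y => f (x - y)) _ y := h1.comp y h2
    rw [h3.fderiv]
    simp
  have hw := (hg.isWeakDeriv j).2.2 _ hψ
  have e1 : (Ω.indicator g ⋆[L.flip, volume] fun a => fderiv ℝ f a (stdVec j)) x =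
      ∫ y in Ω, weakDeriv Ω j g y * f (x - y) := by
    have e2 : (Ω.indicator g ⋆[L.flip, volume] fun a => fderiv ℝ f a (stdVec j)) x =
        -∫ y in Ω, g y * fderiv ℝ (fun y => f (x - y)) y (stdVec j) := by
      rw [← integral_neg, ← integral_indicator hΩ.measurableSet]
      refine integral_congr_ae (.of_forall fun y => ?_)
      by_cases hy : y ∈ Ω
      · simp [Set.indicator_of_mem hy, hder, L, mul_comm]
      · simp [Set.indicator_of_notMem hy]
    rw [e2, hw, neg_neg]
  rw [e1]
  have hint : Integrable (fun y => f (x - y)) (vol Ω) :=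
    memLp_one_iff_integrable.1 (hψ.memLp 1)
  calc ‖∫ y in Ω, weakDeriv Ω j g y * f (x - y)‖
      ≤ ∫ y in Ω, lpNorm (weakDeriv Ω j g) ∞ (vol Ω) * f (x - y) := by
        refine norm_integral_le_of_norm_le (hint.const_mul _) ?_
        filter_upwards [ae_le_lpNorm_exponent_top (hg.memLp_weakDeriv hΩ j)] with y hy
        rw [norm_mul, Real.norm_of_nonneg (φ.nonneg_normed (x - y))]
        exact mul_le_mul_of_nonneg_right hy (φ.nonneg_normed _)
    _ = lpNorm (weakDeriv Ω j g) ∞ (vol Ω) * ∫ y, f (x - y) := by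
        rw [integral_const_mul, setIntegral_eq_integral_of_forall_compl_eq_zero
          (fun y hy => hψ.eq_zero_of_notMem hy)]
    _ = _ := by
        rw [integral_sub_left_eq_self f volume x, φ.integral_normed, mul_one]

/-- A `W^{1,∞}` function is Lipschitz on small balls, up to a null set. -/
theorem MemW1.exists_ae_lipschitz (hΩ : IsOpen Ω) (hb : Bornology.IsBounded Ω) {g : E d → ℝ}
    (hg : MemW1 Ω ∞ g) :
    ∃ L : ℝ, 0 ≤ L ∧ ∀ (x : E d) (r : ℝ), 0 < r → Metric.ball x (2 * r) ⊆ Ω →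
      ∃ G : Set (E d), (∀ᵐ y ∂(volume.restrict (Metric.ball x r)), y ∈ G) ∧
        ∀ y ∈ G, ∀ z ∈ G, |g y - g z| ≤ L * dist y z := by
  have hfin := isFiniteMeasure_vol hb
  have hgi : Integrable g (vol Ω) := hg.1.integrable (by simp)
  refine ⟨∑ j, lpNorm (weakDeriv Ω j g) ∞ (vol Ω),
    Finset.sum_nonneg fun _ _ => lpNorm_nonneg, fun x r hr hball => ?_⟩
  have hpos : ∀ k : ℕ, 0 < r / (k + 2) := fun k => by positivity
  -- The outer radii are at most `r` and tend to zero, so balls of these radii centred in `ball x r`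
  -- stay in `ball x (2r)`. The fixed ratio `2` of the radii is needed for Lebesgue differentiation.
  let φ : ℕ → ContDiffBump (0 : E d) := fun k =>
    ⟨r / (k + 2) / 2, r / (k + 2), half_pos (hpos k), half_lt_self (hpos k)⟩
  have hφ0 : Filter.Tendsto (fun k => (φ k).rOut) Filter.atTop (nhds 0) := by
    have h := (tendsto_one_div_add_atTop_nhds_zero_nat (𝕜 := ℝ)).comp (Filter.tendsto_add_atTop_nat 1)
      |>.const_mul r
    rw [mul_zero] at h
    refine h.congr fun k => ?_
    simp only [Function.comp, φ]
    push_cast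
    rw [mul_one_div]
    congr 1
    ring
  have hloc : LocallyIntegrable (Ω.indicator g) volume :=
    ((integrable_indicator_iff hΩ.measurableSet).2 hgi).locallyIntegrable
  have hae := ContDiffBump.ae_convolution_tendsto_right_of_locallyIntegrable (K := 2) hφ0
    (.of_forall fun k => by simp only [φ]; linarith) hloc
  refine ⟨_, ((ae_restrict_of_ae hae).and (ae_restrict_mem Metric.isOpen_ball.measurableSet)),
    ?_⟩
  rintro y ⟨hy, hyb⟩ z ⟨hz, hzb⟩
  have hsub : Metric.ball x r ⊆ Ω := (Metric.ball_subset_ball (by linarith)).trans hball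
  rw [Set.indicator_of_mem (hsub hyb)] at hy
  rw [Set.indicator_of_mem (hsub hzb)] at hz
  refine le_of_tendsto ((hy.sub hz).abs) (.of_forall fun k => ?_)
  have hk : ∀ w ∈ Metric.ball x r, Metric.closedBall w (φ k).rOut ⊆ Ω := by
    intro w hw v hv
    refine hball ?_
    have h1 : (φ k).rOut ≤ r := by
      simp only [φ]
      refine div_le_self hr.le ?_
      have : (0 : ℝ) ≤ k := by positivity
      linarith
    rw [Metric.mem_ball] at hw ⊢
    rw [Metric.mem_closedBall] at hv
    linarith [dist_triangle v w x]
  -- The mean value inequality on the convex ball gives a Lipschitz constant independent of `k`,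
  -- which survives the limit at points where the mollifications converge.
  have hmv := (convex_ball x r).norm_image_sub_le_of_norm_fderiv_le
    (fun w hw => (norm_fderiv_convolution_le hΩ hg hgi (φ k) (hk w hw)).1)
    (fun w hw => (norm_fderiv_convolution_le hΩ hg hgi (φ k) (hk w hw)).2) hzb hyb
  rw [dist_eq_norm]
  exact hmv

/-- A set that is null near each of its points is null, by second countability. -/
theorem ae_vol_of_forall_ball {P : E d → Prop} (hΩ : IsOpen Ω)
    (h : ∀ x ∈ Ω, ∃ s > 0, ∀ᵐ y ∂(volume.restrict (Metric.ball x s)), P y) :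
    ∀ᵐ x ∂(vol Ω), P x := by
  rw [ae_restrict_iff' hΩ.measurableSet, ae_iff]
  refine measure_null_of_locally_null _ fun x hx => ?_
  simp only [Classical.not_imp, Set.mem_ofPred_eq] at hx
  obtain ⟨s, hs, hP⟩ := h x hx.1
  rw [ae_restrict_iff' Metric.isOpen_ball.measurableSet, ae_iff] at hP
  refine ⟨_, Filter.inter_mem (mem_nhdsWithin_of_mem_nhds (Metric.ball_mem_nhds x hs))
    self_mem_nhdsWithin, measure_mono_null (fun y hy => ?_) hP⟩
  simp only [Classical.not_imp, Set.mem_ofPred_eq, Set.mem_inter_iff] at hy ⊢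
  exact ⟨hy.1, hy.2.2⟩

theorem isOpen_setOf_exists_ball_ae (P : E d → Prop) :
    IsOpen {x : E d | ∃ s > 0, ∀ᵐ y ∂(volume.restrict (Metric.ball x s)), P y} := by
  rw [Metric.isOpen_iff]
  rintro x ⟨s, hs, h⟩
  refine ⟨s, hs, fun y hy => ⟨s - dist y x, by simpa using hy, ?_⟩⟩
  refine ae_restrict_of_ae_restrict_of_subset (Metric.ball_subset_ball' ?_) h
  linarith

/-- On a connected set, the essential range of a `W^{1,∞}` function has no gap. -/
theorem MemW1.not_ae_le_abs_sub (hΩ : IsOpen Ω) (hb : Bornology.IsBounded Ω)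
    (hc : IsConnected Ω) {g : E d → ℝ} (hg : MemW1 Ω ∞ g) {r ε : ℝ}
    (hr : r ∈ Set.Icc (rhoMin Ω g) (rhoMax Ω g)) (hε : 0 < ε) :
    ¬ ∀ᵐ x ∂(vol Ω), ε ≤ |g x - r| := by
  intro hgap
  have hne : (ae (vol Ω)).NeBot := by
    rw [ae_neBot]
    intro h
    rw [Measure.restrict_eq_zero] at h
    exact (hΩ.measure_pos volume hc.nonempty).ne' h
  obtain ⟨L, hL, hlip⟩ := hg.exists_ae_lipschitz hΩ hb
  -- A gap around `r` would split `Ω` into the open sets where `g` is locally below and locally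
  -- above it. Connectedness leaves only one of them, so `r` would lie outside the essential range
  -- interval.
  set U := {x : E d | ∃ s > 0, ∀ᵐ y ∂(volume.restrict (Metric.ball x s)), g y ≤ r - ε}
  set V := {x : E d | ∃ s > 0, ∀ᵐ y ∂(volume.restrict (Metric.ball x s)), r + ε ≤ g y}
  have hUV : Disjoint U V := by
    rw [Set.disjoint_left]
    rintro x ⟨s, hs, h1⟩ ⟨t, ht, h2⟩
    have h1' := ae_restrict_of_ae_restrict_of_subset
      (Metric.ball_subset_ball (min_le_left s t) : Metric.ball x _ ⊆ _) h1
    have h2' := ae_restrict_of_ae_restrict_of_subset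
      (Metric.ball_subset_ball (min_le_right s t) : Metric.ball x _ ⊆ _) h2
    have : (ae (volume.restrict (Metric.ball x (min s t)))).NeBot := by
      rw [ae_neBot]
      intro h
      rw [Measure.restrict_eq_zero] at h
      exact (Metric.measure_ball_pos volume x (lt_min hs ht)).ne' h
    obtain ⟨y, h3, h4⟩ := (h1'.and h2').exists
    linarith
  have hcov : Ω ⊆ U ∪ V := by
    intro x hx
    obtain ⟨s, hs, hball⟩ := Metric.isOpen_iff.1 hΩ x hx
    -- On a ball of this radius `g` oscillates by less than `2 * ε`, too little to cross the gap
    -- from `r - ε` to `r + ε`.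
    set t := min (s / 2) (ε / (2 * (L + 1)))
    have ht : 0 < t := lt_min (by positivity) (by positivity)
    have ht1 : 2 * t ≤ s := by linarith [min_le_left (s / 2) (ε / (2 * (L + 1)))]
    have ht2 : L * (2 * t) < 2 * ε := by
      have h1 : t * (2 * (L + 1)) ≤ ε :=
        (le_div_iff₀ (by positivity)).1 (min_le_right (s / 2) (ε / (2 * (L + 1))))
      nlinarith
    obtain ⟨G, hG, hGl⟩ := hlip x t ht ((Metric.ball_subset_ball ht1).trans hball)
    have hA : ∀ᵐ y ∂(volume.restrict (Metric.ball x t)), ε ≤ |g y - r| :=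
      ae_restrict_of_ae_restrict_of_subset
        ((Metric.ball_subset_ball (by linarith)).trans hball) hgap
    have hB := ae_restrict_mem (μ := (volume : Measure (E d)))
      (Metric.isOpen_ball (x := x) (ε := t)).measurableSet
    by_cases hex : ∃ y ∈ G, y ∈ Metric.ball x t ∧ g y ≤ r - ε
    · obtain ⟨y, hyG, hyb, hy⟩ := hex
      refine Or.inl ⟨t, ht, ?_⟩
      filter_upwards [hG, hA, hB] with z hzG hzA hzb
      have h1 := hGl z hzG y hyG
      have h2 : dist z y < 2 * t := by
        rw [Metric.mem_ball] at hyb hzb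
        linarith [dist_triangle_right z y x]
      have h3 : L * dist z y ≤ L * (2 * t) := mul_le_mul_of_nonneg_left h2.le hL
      have h4 := le_abs_self (g z - g y)
      rcases le_abs.1 hzA with h | h <;> linarith
    · push Not at hex
      refine Or.inr ⟨t, ht, ?_⟩
      filter_upwards [hG, hA, hB] with z hzG hzA hzb
      have h1 := hex z hzG hzb
      rcases le_abs.1 hzA with h | h <;> linarith
  have hbound : ∀ᵐ x ∂(vol Ω), |g x| ≤ lpNorm g ∞ (vol Ω) := ae_le_lpNorm_exponent_top hg.1
  rcases hc.isPreconnected.subset_or_subset (isOpen_setOf_exists_ball_ae _)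
    (isOpen_setOf_exists_ball_ae _) hUV hcov with h | h
  · have hle : ∀ᵐ x ∂(vol Ω), g x ≤ r - ε := ae_vol_of_forall_ball hΩ fun x hx => h hx
    have : rhoMax Ω g ≤ r - ε :=
      Filter.limsup_le_of_le (Filter.IsBoundedUnder.isCoboundedUnder_le
        ⟨-lpNorm g ∞ (vol Ω), Filter.eventually_map.2
          (hbound.mono fun x hx => (abs_le.1 hx).1)⟩) hle
    linarith [hr.2]
  · have hle : ∀ᵐ x ∂(vol Ω), r + ε ≤ g x := ae_vol_of_forall_ball hΩ fun x hx => h hx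
    have : r + ε ≤ rhoMin Ω g :=
      Filter.le_liminf_of_le (Filter.IsBoundedUnder.isCoboundedUnder_ge
        ⟨lpNorm g ∞ (vol Ω), Filter.eventually_map.2
          (hbound.mono fun x hx => (abs_le.1 hx).2)⟩) hle
    linarith [hr.1]

/-- Outside the interval `h` may be arbitrary, even nonmeasurable; measurability comes from the
continuous extension of `h` by its end values, which agrees almost everywhere after composition. An
empty interval forces the measure to vanish. -/
theorem memLp_top_comp_of_continuousOn {α : Type*} [MeasurableSpace α] {μ : Measure α}
    {h : ℝ → ℝ} {a b : ℝ} (hh : ContinuousOn h (Set.Icc a b)) {g : α → ℝ}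
    (hg : AEStronglyMeasurable g μ) (hgab : ∀ᵐ x ∂μ, a ≤ g x ∧ g x ≤ b) :
    MemLp (fun x => h (g x)) ∞ μ := by
  obtain ⟨K, hK⟩ := isCompact_Icc.exists_bound_of_continuousOn hh
  refine memLp_top_of_bound ?_ K (hgab.mono fun x hx => hK _ hx)
  by_cases hab : a ≤ b
  · have hc : Continuous (Set.IccExtend hab (Set.domRestrict (Set.Icc a b) h)) :=
      hh.domRestrict.Icc_extend'
    refine (hc.comp_aestronglyMeasurable hg).congr (hgab.mono fun x hx => ?_)
    exact Set.IccExtend_of_mem hab _ hx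
  · have : ∀ᵐ x ∂μ, False := hgab.mono fun x hx => hab (hx.1.trans hx.2)
    rw [ae_iff] at this
    simp only [not_false_eq_true, Set.ofPred_true, Measure.measure_univ_eq_zero] at this
    rw [this]
    exact aestronglyMeasurable_zero_measure _

/-- If `|h r|` exceeded the essential supremum, continuity would keep `|h|` above it near `r`, and
`g` would have to avoid a neighbourhood of `r`. This transfers bounds seen at the initial density to
every density between its extremes. -/
theorem MemW1.abs_le_lpNorm_comp (hΩ : IsOpen Ω) (hb : Bornology.IsBounded Ω)
    (hc : IsConnected Ω) {g : E d → ℝ} (hg : MemW1 Ω ∞ g)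
    (hgab : ∀ᵐ x ∂(vol Ω), rhoMin Ω g ≤ g x ∧ g x ≤ rhoMax Ω g) {h : ℝ → ℝ}
    (hh : ContinuousOn h (Set.Icc (rhoMin Ω g) (rhoMax Ω g))) {r : ℝ}
    (hr : r ∈ Set.Icc (rhoMin Ω g) (rhoMax Ω g)) :
    |h r| ≤ lpNorm (fun x => h (g x)) ∞ (vol Ω) := by
  by_contra! hlt
  have hev := (hh.abs r hr).eventually (lt_mem_nhds hlt)
  rw [Filter.Eventually, Metric.mem_nhdsWithin_iff] at hev
  obtain ⟨ε, hε, hsub⟩ := hev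
  refine hg.not_ae_le_abs_sub hΩ hb hc hr hε ?_
  filter_upwards [hgab,
    ae_le_lpNorm_exponent_top (memLp_top_comp_of_continuousOn hh hg.1.1 hgab)] with x hx1 hx2
  by_contra! hlt'
  have : lpNorm (fun x => h (g x)) ∞ (vol Ω) < |h (g x)| :=
    hsub ⟨by rwa [Metric.mem_ball, Real.dist_eq], hx1⟩
  rw [Real.norm_eq_abs] at hx2
  linarith

/-! ### Contractions of matrices -/

/-- The symmetric part of a matrix. -/
noncomputable def symPart (G : Matrix (Fin d) (Fin d) ℝ) : Matrix (Fin d) (Fin d) ℝ :=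
  (1 / 2 : ℝ) • (G + G.transpose)

theorem symPart_apply (G : Matrix (Fin d) (Fin d) ℝ) (i j : Fin d) :
    symPart G i j = 1 / 2 * (G i j + G j i) := rfl

theorem strain_eq_symPart (v : E d → E d) (x : E d) : strain Ω v x = symPart (jac Ω v x) := rfl

theorem contr_symPart_left (G H : Matrix (Fin d) (Fin d) ℝ) :
    contr (symPart G) H = contr G (symPart H) := by
  simp only [contr, symPart_apply, mul_add, add_mul, Finset.sum_add_distrib]
  congr 1
  · exact Finset.sum_congr rfl fun i _ => Finset.sum_congr rfl fun j _ => by ring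
  · rw [Finset.sum_comm]
    exact Finset.sum_congr rfl fun i _ => Finset.sum_congr rfl fun j _ => by ring

theorem symPart_symPart (G : Matrix (Fin d) (Fin d) ℝ) : symPart (symPart G) = symPart G := by
  ext i j
  simp only [symPart_apply]
  ring

theorem contr_comm (G H : Matrix (Fin d) (Fin d) ℝ) : contr G H = contr H G := by
  simp only [contr, mul_comm]

theorem contr_self_nonneg (G : Matrix (Fin d) (Fin d) ℝ) : 0 ≤ contr G G :=
  Finset.sum_nonneg fun _ _ => Finset.sum_nonneg fun _ _ => mul_self_nonneg _

theorem contr_sub_left (G H K : Matrix (Fin d) (Fin d) ℝ) :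
    contr (G - H) K = contr G K - contr H K := by
  simp [contr, sub_mul, Finset.sum_sub_distrib]

theorem contr_add_left (G H K : Matrix (Fin d) (Fin d) ℝ) :
    contr (G + H) K = contr G K + contr H K := by
  simp [contr, add_mul, Finset.sum_add_distrib]

theorem contr_smul_left (c : ℝ) (G H : Matrix (Fin d) (Fin d) ℝ) :
    contr (c • G) H = c * contr G H := by
  simp [contr, Finset.mul_sum, mul_assoc]

theorem frob_sq (G : Matrix (Fin d) (Fin d) ℝ) : frob G ^ 2 = contr G G :=
  Real.sq_sqrt (contr_self_nonneg G)

/-- Cauchy–Schwarz over index pairs; the Frobenius norm of `v ⊗ w` is `|v| |w|`. -/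
theorem sq_contr_vecMulVec_le (v w : Fin d → ℝ) (H : Matrix (Fin d) (Fin d) ℝ) :
    contr (Matrix.vecMulVec v w) H ^ 2 ≤ (∑ i, v i ^ 2) * (∑ j, w j ^ 2) * contr H H := by
  have e : ∀ A B : Matrix (Fin d) (Fin d) ℝ,
      contr A B = ∑ k : Fin d × Fin d, A k.1 k.2 * B k.1 k.2 := fun A B => by
    rw [contr, Fintype.sum_prod_type]
  have h := Finset.sum_mul_sq_le_sq_mul_sq Finset.univ
    (fun k : Fin d × Fin d => v k.1 * w k.2) (fun k => H k.1 k.2)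
  rw [e, e H H, Finset.sum_mul_sum, ← Fintype.sum_prod_type']
  simp only [Matrix.vecMulVec_apply]
  refine h.trans (le_of_eq ?_)
  simp only [mul_pow]
  simp only [sq]

theorem abs_le_add_of_sq_le {x a b : ℝ} (ha : 0 ≤ a) (hb : 0 ≤ b) (h : x ^ 2 ≤ 4 * (a * b)) :
    |x| ≤ a + b := by
  refine abs_le_of_sq_le_sq (h.trans ?_) (add_nonneg ha hb)
  nlinarith [sq_nonneg (a - b)]

/-! ### The energy inequality at a point -/

/-- The algebraic core of the energy inequality, in terms of scalar products: `q, q', c` are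
`|u|², |u'|², u·u'`, `k, k', l` are `|ε|², |ε'|², ε:ε'`, and `W`, `w` are the products with the
density gradient. -/
theorem scalar_energy_le {q q' c k k' l D D' φ T s W w h r r' e p R τ lam nub lamb γ₁ γ₂ : ℝ}
    (hτ : 0 < τ) (hlam : 0 < lam) (hr : 0 ≤ r) (he : 0 ≤ e)
    (hR : (r' - r) / τ + s = R) (h1 : e ≤ nub * r') (h2 : lam ≤ lamb * r')
    (h3 : nub * (r' - r) ≤ e) (h4 : lamb * (r' - r) ≤ lam)
    (h5 : 8 * τ * nub ^ 2 * h ≤ γ₁ ^ 2 * (r * e)) (h6 : 2 * τ * lamb ^ 2 * h ≤ γ₂ ^ 2 * (r * e))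
    (hq : 0 ≤ q - 2 * c + q') (hk : 0 ≤ k) (hk' : 0 ≤ k') (hkl : 0 ≤ k - 2 * l + k')
    (hW : W ^ 2 ≤ (q - 2 * c + q') * h * k') (hw : w ^ 2 ≤ (q - 2 * c + q') * h) :
    r' * q' + 2 * τ * nub * (r' * k') + τ * lamb * (r' * D' ^ 2) + τ / lam * (p - lam * D') ^ 2
        + 2 * τ * (e * k')
      ≤ r * q + 2 * τ * nub * (r * k) + τ * lamb * (r * D ^ 2) + τ / lam * p ^ 2 + 2 * τ * φ
        + 2 * τ * ((1 / τ) * (r' * q' - r * c) - 1 / 2 * r * D * q' - 1 / 2 * R * q' - φ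
          + 2 * nub * (r' * (k' - l) + W) + 2 * e * l
          + (lamb * (r' * (D' - D) + w) + lam * D - p) * D' - r * T)
        + τ * (2 * r * T + (r * D + s) * q')
        + γ₁ ^ 2 * τ * (e * k') + γ₂ ^ 2 * τ * (e * D' ^ 2) := by
  set N := q - 2 * c + q'
  -- Young's inequality for the density gradient term: half of `r * N`, the numerical dissipation,
  -- is used here and the other half in `b2`. The constant `8` in `h5` is what makes the squares
  -- match.
  have b1 : |4 * τ * nub * W| ≤ 1 / 2 * (r * N) + γ₁ ^ 2 * τ * (e * k') := by
    refine abs_le_add_of_sq_le (by positivity) (by positivity) ?_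
    calc (4 * τ * nub * W) ^ 2 = 16 * τ ^ 2 * nub ^ 2 * W ^ 2 := by ring
      _ ≤ 16 * τ ^ 2 * nub ^ 2 * (N * h * k') := by gcongr
      _ = 2 * τ * N * k' * (8 * τ * nub ^ 2 * h) := by ring
      _ ≤ 2 * τ * N * k' * (γ₁ ^ 2 * (r * e)) := by gcongr
      _ = _ := by ring
  have b2 : |2 * τ * lamb * w * D'| ≤ 1 / 2 * (r * N) + γ₂ ^ 2 * τ * (e * D' ^ 2) := by
    refine abs_le_add_of_sq_le (by positivity) (by positivity) ?_
    calc (2 * τ * lamb * w * D') ^ 2 = 4 * τ ^ 2 * lamb ^ 2 * D' ^ 2 * w ^ 2 := by ring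
      _ ≤ 4 * τ ^ 2 * lamb ^ 2 * D' ^ 2 * (N * h) := by gcongr
      _ = 2 * τ * N * D' ^ 2 * (2 * τ * lamb ^ 2 * h) := by ring
      _ ≤ 2 * τ * N * D' ^ 2 * (γ₂ ^ 2 * (r * e)) := by gcongr
      _ = _ := by ring
  have b3 := neg_abs_le (4 * τ * nub * W)
  have b4 := neg_abs_le (2 * τ * lamb * w * D')
  -- The polarization remainders: `c1` and `c2` come from `2l = k + k' - |ε' - ε|²`, `c3` and `c4`
  -- from `2DD' = D² + D'² - (D' - D)²`.
  have c1 : 0 ≤ τ * ((nub * r' - e) * (k - 2 * l + k')) :=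
    mul_nonneg hτ.le (mul_nonneg (by linarith) hkl)
  have c2 : 0 ≤ τ * ((e - nub * (r' - r)) * k) := mul_nonneg hτ.le (mul_nonneg (by linarith) hk)
  have c3 : 0 ≤ τ * ((lamb * r' - lam) * (D' - D) ^ 2) :=
    mul_nonneg hτ.le (mul_nonneg (by linarith) (sq_nonneg _))
  have c4 : 0 ≤ τ * ((lam - lamb * (r' - r)) * D ^ 2) :=
    mul_nonneg hτ.le (mul_nonneg (by linarith) (sq_nonneg _))
  have hp : τ / lam * (p - lam * D') ^ 2 = τ / lam * p ^ 2 - 2 * τ * p * D' + τ * lam * D' ^ 2 := by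
    field_simp
    ring
  have ht : 2 * τ * (1 / τ * (r' * q' - r * c)) = 2 * (r' * q' - r * c) := by
    field_simp
  -- The density equation removes `R`: half of it corrects the coefficient of `q'` from the
  -- polarized time derivative, and the transport part `s` cancels against the convection identity.
  have hRτ : τ * R = r' - r + τ * s := by
    rw [← hR]
    field_simp
  have hRq : τ * R * q' = (r' - r + τ * s) * q' := by rw [hRτ]
  rw [hp]
  have hN : r * N = r * q - 2 * (r * c) + r * q' := by ring
  nlinarith only [b1, b2, b3, b4, c1, c2, c3, c4, ht, hRq, hN]

/-- The energy inequality at a point. -/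
theorem pointwise_energy_le {U U' F g a : Fin d → ℝ} {G G' : Matrix (Fin d) (Fin d) ℝ}
    {r r' e p p' R τ lam nub lamb γ₁ γ₂ : ℝ}
    (hτ : 0 < τ) (hlam : 0 < lam) (hr : 0 ≤ r) (he : 0 ≤ e)
    (hR : (r' - r) / τ + ∑ j, U j * a j = R) (hp : p' = p - lam * ∑ i, G' i i)
    (h1 : e ≤ nub * r') (h2 : lam ≤ lamb * r')
    (h3 : nub * (r' - r) ≤ e) (h4 : lamb * (r' - r) ≤ lam)
    (h5 : 8 * τ * nub ^ 2 * ∑ j, g j ^ 2 ≤ γ₁ ^ 2 * (r * e))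
    (h6 : 2 * τ * lamb ^ 2 * ∑ j, g j ^ 2 ≤ γ₂ ^ 2 * (r * e)) :
    r' * ∑ i, U' i ^ 2 + 2 * τ * nub * (r' * contr (symPart G') (symPart G'))
        + τ * lamb * (r' * (∑ i, G' i i) ^ 2) + τ / lam * p' ^ 2
        + 2 * τ * (e * contr (symPart G') (symPart G'))
      ≤ r * ∑ i, U i ^ 2 + 2 * τ * nub * (r * contr (symPart G) (symPart G))
        + τ * lamb * (r * (∑ i, G i i) ^ 2) + τ / lam * p ^ 2 + 2 * τ * ∑ i, F i * U' i
        + 2 * τ * ∑ i, (((1 / τ) * (r' * U' i - r * U i) - 1 / 2 * r * (∑ i, G i i) * U' i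
            - 1 / 2 * R * U' i - F i) * U' i
          + ∑ j, (2 * nub * symPart (r' • (G' - G) + Matrix.vecMulVec (U' - U) g) i j
            + 2 * e * symPart G i j
            + (if j = i then lamb * (∑ k, (r' * (G' k k - G k k) + (U' k - U k) * g k))
              + lam * (∑ i, G i i) - p else 0) - r * (U' i * U j)) * G' i j)
        + τ * ∑ i, ∑ j, (2 * (r * U j * U' i * G' i j) + (r * G j j + a j * U j) * U' i ^ 2)
        + γ₁ ^ 2 * τ * (e * contr (symPart G') (symPart G'))
        + γ₂ ^ 2 * τ * (e * (∑ i, G' i i) ^ 2) := by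
  -- Symmetrization is self-adjoint for the contraction, so the full gradient of `u'` may be
  -- replaced by its symmetric part.
  have hS : ∑ i, ∑ j, symPart (r' • (G' - G) + Matrix.vecMulVec (U' - U) g) i j * G' i j =
      r' * (contr (symPart G') (symPart G') - contr (symPart G) (symPart G'))
        + contr (Matrix.vecMulVec (U' - U) g) (symPart G') := by
    change contr _ _ = _
    rw [contr_symPart_left, contr_add_left, contr_smul_left, contr_sub_left,
      ← symPart_symPart G', ← contr_symPart_left, ← contr_symPart_left G, symPart_symPart]
  have hw : ∑ k, (r' * (G' k k - G k k) + (U' k - U k) * g k) =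
      r' * (∑ i, G' i i - ∑ i, G i i) + ∑ k, (U' k - U k) * g k := by
    rw [Finset.sum_add_distrib, ← Finset.mul_sum, Finset.sum_sub_distrib]
  have hX : ∑ i, (((1 / τ) * (r' * U' i - r * U i) - 1 / 2 * r * (∑ i, G i i) * U' i
            - 1 / 2 * R * U' i - F i) * U' i
          + ∑ j, (2 * nub * symPart (r' • (G' - G) + Matrix.vecMulVec (U' - U) g) i j
            + 2 * e * symPart G i j
            + (if j = i then lamb * (∑ k, (r' * (G' k k - G k k) + (U' k - U k) * g k))
              + lam * (∑ i, G i i) - p else 0) - r * (U' i * U j)) * G' i j) =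
      (1 / τ) * (r' * ∑ i, U' i ^ 2 - r * ∑ i, U i * U' i)
        - 1 / 2 * r * (∑ i, G i i) * ∑ i, U' i ^ 2
        - 1 / 2 * R * ∑ i, U' i ^ 2 - ∑ i, F i * U' i
        + 2 * nub * (r' * (contr (symPart G') (symPart G') - contr (symPart G) (symPart G'))
          + contr (Matrix.vecMulVec (U' - U) g) (symPart G'))
        + 2 * e * contr (symPart G) (symPart G')
        + (lamb * (r' * (∑ i, G' i i - ∑ i, G i i) + ∑ k, (U' k - U k) * g k)
          + lam * (∑ i, G i i) - p) * (∑ i, G' i i)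
        - r * ∑ i, ∑ j, U' i * U j * G' i j := by
    have hl : contr (symPart G) (symPart G') = ∑ i, ∑ j, symPart G i j * G' i j := by
      rw [contr_symPart_left, symPart_symPart, ← contr_symPart_left]
      rfl
    rw [← hS, hl, ← hw]
    set S := symPart (r' • (G' - G) + Matrix.vecMulVec (U' - U) g)
    set Z := ∑ k, (r' * (G' k k - G k k) + (U' k - U k) * g k)
    simp only [sub_mul, add_mul, ite_mul, zero_mul, Finset.sum_add_distrib,
      Finset.sum_sub_distrib, Finset.sum_ite_eq', Finset.mem_univ, if_true, Finset.mul_sum,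
      mul_sub]
    have sq' : ∀ i, U' i ^ 2 = U' i * U' i := fun i => sq _
    simp only [sq', mul_assoc, Finset.sum_mul]
    ring
  have hK : ∑ i, ∑ j, (2 * (r * U j * U' i * G' i j) + (r * G j j + a j * U j) * U' i ^ 2) =
      2 * r * (∑ i, ∑ j, U' i * U j * G' i j)
        + (r * (∑ i, G i i) + ∑ j, U j * a j) * ∑ i, U' i ^ 2 := by
    simp only [Finset.sum_add_distrib, ← Finset.sum_mul, ← Finset.mul_sum]
    congr 1
    · simp only [Finset.mul_sum]
      exact Finset.sum_congr rfl fun i _ => Finset.sum_congr rfl fun j _ => by ring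
    · simp only [mul_comm (a _)]
  rw [hX, hK, hp]
  have hq : ∑ i, (U' i - U i) ^ 2 = ∑ i, U i ^ 2 - 2 * ∑ i, U i * U' i + ∑ i, U' i ^ 2 := by
    rw [Finset.mul_sum, ← Finset.sum_sub_distrib, ← Finset.sum_add_distrib]
    exact Finset.sum_congr rfl fun i _ => by ring
  have hkl : contr (symPart G' - symPart G) (symPart G' - symPart G) =
      contr (symPart G) (symPart G) - 2 * contr (symPart G) (symPart G')
        + contr (symPart G') (symPart G') := by
    rw [contr_sub_left, contr_comm _ (symPart G' - symPart G), contr_sub_left,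
      contr_comm _ (symPart G' - symPart G), contr_sub_left, contr_comm (symPart G') (symPart G)]
    ring
  refine scalar_energy_le hτ hlam hr he hR h1 h2 h3 h4 h5 h6 ?_ (contr_self_nonneg _)
    (contr_self_nonneg _) ?_ ?_ ?_
  · rw [← hq]
    exact Finset.sum_nonneg fun _ _ => sq_nonneg _
  · rw [← hkl]
    exact contr_self_nonneg _
  · rw [← hq]
    exact sq_contr_vecMulVec_le _ _ _
  · rw [← hq]
    exact Finset.sum_mul_sq_le_sq_mul_sq _ _ _

/-! ### Weighted norms as integrals -/

theorem lpNorm_two_sq {α F : Type*} [MeasurableSpace α] {μ : Measure α} [NormedAddCommGroup F]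
    {f : α → F} (hf : AEStronglyMeasurable f μ) : lpNorm f 2 μ ^ 2 = ∫ x, ‖f x‖ ^ 2 ∂μ := by
  rw [lpNorm_eq_integral_norm_rpow_toReal (by norm_num) (by norm_num) hf]
  simp only [ENNReal.toReal_ofNat, Real.rpow_ofNat]
  rw [← Real.rpow_natCast, ← Real.rpow_mul (integral_nonneg fun _ => by positivity)]
  norm_num

theorem aestronglyMeasurable_sqrt {α : Type*} [MeasurableSpace α] {μ : Measure α} {w : α → ℝ}
    (hw : AEStronglyMeasurable w μ) : AEStronglyMeasurable (fun x => √(w x)) μ :=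
  Real.continuous_sqrt.comp_aestronglyMeasurable hw

namespace MemH1Vec

variable {v : E d → E d} {w : E d → ℝ}

theorem memLp (hv : MemH1Vec Ω v) : MemLp v 2 (vol Ω) := memLp_piLp_iff.2 fun i => (hv i).1

theorem memLp_jac (hΩ : IsOpen Ω) (hv : MemH1Vec Ω v) (i j : Fin d) :
    MemLp (fun x => jac Ω v x i j) 2 (vol Ω) := (hv i).memLp_weakDeriv hΩ j

theorem memLp_strain (hΩ : IsOpen Ω) (hv : MemH1Vec Ω v) (i j : Fin d) :
    MemLp (fun x => strain Ω v x i j) 2 (vol Ω) :=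
  ((hv.memLp_jac hΩ i j).add (hv.memLp_jac hΩ j i)).const_mul (1 / 2)

theorem memLp_dvg (hΩ : IsOpen Ω) (hv : MemH1Vec Ω v) : MemLp (dvg Ω v) 2 (vol Ω) :=
  memLp_finsetSum _ fun i _ => hv.memLp_jac hΩ i i

theorem integrable_sum_sq (hv : MemH1Vec Ω v) :
    Integrable (fun x => ∑ i, v x i ^ 2) (vol Ω) :=
  integrable_finsetSum _ fun i _ => (hv i).1.integrable_sq

theorem integrable_contr_strain (hΩ : IsOpen Ω) (hv : MemH1Vec Ω v) :
    Integrable (fun x => contr (strain Ω v x) (strain Ω v x)) (vol Ω) :=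
  integrable_finsetSum _ fun i _ => integrable_finsetSum _ fun j _ =>
    integrable_mul_two (hv.memLp_strain hΩ i j) (hv.memLp_strain hΩ i j)

theorem integrable_dvg_sq (hΩ : IsOpen Ω) (hv : MemH1Vec Ω v) :
    Integrable (fun x => dvg Ω v x ^ 2) (vol Ω) := (hv.memLp_dvg hΩ).integrable_sq

theorem normVec_sq (hv : MemH1Vec Ω v) (hw : AEStronglyMeasurable w (vol Ω))
    (hw0 : ∀ᵐ x ∂(vol Ω), 0 ≤ w x) :
    normVec Ω w v ^ 2 = ∫ x in Ω, w x * ∑ i, v x i ^ 2 := by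
  rw [normVec, lpNorm_two_sq (f := fun x => √(w x) • v x)
    ((aestronglyMeasurable_sqrt hw).smul hv.memLp.1)]
  refine integral_congr_ae (hw0.mono fun x hx => ?_)
  simp only [norm_smul, mul_pow, EuclideanSpace.norm_sq_eq, Real.norm_eq_abs, sq_abs,
    Real.sq_sqrt hx]

theorem aestronglyMeasurable_frob_strain (hΩ : IsOpen Ω) (hv : MemH1Vec Ω v) :
    AEStronglyMeasurable (fun x => frob (strain Ω v x)) (vol Ω) :=
  aestronglyMeasurable_sqrt (hv.integrable_contr_strain hΩ).1

theorem normStrain_sq (hΩ : IsOpen Ω) (hv : MemH1Vec Ω v)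
    (hw : AEStronglyMeasurable w (vol Ω)) (hw0 : ∀ᵐ x ∂(vol Ω), 0 ≤ w x) :
    normStrain Ω w v ^ 2 = ∫ x in Ω, w x * contr (strain Ω v x) (strain Ω v x) := by
  rw [normStrain, lpNorm_two_sq (f := fun x => √(w x) * frob (strain Ω v x))
    ((aestronglyMeasurable_sqrt hw).mul (hv.aestronglyMeasurable_frob_strain hΩ))]
  refine integral_congr_ae (hw0.mono fun x hx => ?_)
  simp only [Real.norm_eq_abs, sq_abs, mul_pow, frob_sq, Real.sq_sqrt hx]

theorem normDvg_sq (hΩ : IsOpen Ω) (hv : MemH1Vec Ω v)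
    (hw : AEStronglyMeasurable w (vol Ω)) (hw0 : ∀ᵐ x ∂(vol Ω), 0 ≤ w x) :
    normDvg Ω w v ^ 2 = ∫ x in Ω, w x * dvg Ω v x ^ 2 := by
  rw [normDvg, lpNorm_two_sq (f := fun x => √(w x) * dvg Ω v x)
    ((aestronglyMeasurable_sqrt hw).mul (hv.memLp_dvg hΩ).1)]
  refine integral_congr_ae (hw0.mono fun x hx => ?_)
  simp only [Real.norm_eq_abs, sq_abs, mul_pow, Real.sq_sqrt hx]

end MemH1Vec

theorem MemH10Vec.memH1Vec {v : E d → E d} (hv : MemH10Vec Ω v) : MemH1Vec Ω v :=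
  fun i => (hv i).1

/-! ### Korn and Poincaré inequalities -/

/-- Korn's inequality on `H¹₀`. -/
theorem MemH10Vec.sum_integral_jac_sq_le (hd : d = 2 ∨ d = 3) (hΩ : IsOpen Ω)
    (hb : Bornology.IsBounded Ω) {v : E d → E d} (hv : MemH10Vec Ω v) :
    ∑ i, ∑ j, ∫ x in Ω, jac Ω v x i j ^ 2 ≤
      2 * ∫ x in Ω, contr (strain Ω v x) (strain Ω v x) := by
  have hJ := hv.memH1Vec.memLp_jac hΩ
  have hint : ∀ i j k l : Fin d, Integrable (fun x => jac Ω v x i j * jac Ω v x k l) (vol Ω) :=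
    fun i j k l => integrable_mul_two (hJ i j) (hJ k l)
  -- Exchanging the mixed derivatives identifies `∫ ∇v : (∇v)ᵀ` with `∫ (div v)² ≥ 0`. Since `2|ε|²
  -- = |∇v|² + ∇v : (∇v)ᵀ`, this is Korn's inequality with constant two.
  have e1 : ∫ x in Ω, dvg Ω v x ^ 2 =
      ∑ i, ∑ j, ∫ x in Ω, jac Ω v x i j * jac Ω v x j i := by
    have h : ∀ x, dvg Ω v x ^ 2 = ∑ i, ∑ j, jac Ω v x i i * jac Ω v x j j := fun x => by
      rw [sq, dvg, Finset.sum_mul_sum]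
      rfl
    simp_rw [h]
    rw [integral_finsetSum _ fun i _ => integrable_finsetSum _ fun j _ => hint _ _ _ _]
    refine Finset.sum_congr rfl fun i _ => ?_
    rw [integral_finsetSum _ fun j _ => hint _ _ _ _]
    refine Finset.sum_congr rfl fun j _ => ?_
    exact integral_weakDeriv_mul_weakDeriv_comm hd hΩ hb (hv i) (hv j) i j
  have e2 : 2 * ∫ x in Ω, contr (strain Ω v x) (strain Ω v x) =
      (∑ i, ∑ j, ∫ x in Ω, jac Ω v x i j ^ 2) +
        ∑ i, ∑ j, ∫ x in Ω, jac Ω v x i j * jac Ω v x j i := by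
    have h : ∀ x, 2 * contr (strain Ω v x) (strain Ω v x) =
        ∑ i, ∑ j, (jac Ω v x i j * jac Ω v x i j + jac Ω v x i j * jac Ω v x j i) := fun x => by
      rw [strain_eq_symPart, contr_symPart_left, symPart_symPart, contr, Finset.mul_sum]
      refine Finset.sum_congr rfl fun i _ => ?_
      rw [Finset.mul_sum]
      refine Finset.sum_congr rfl fun j _ => ?_
      rw [symPart_apply]
      ring
    rw [← integral_const_mul]
    simp_rw [h, sq]
    have hint' : ∀ i j : Fin d, Integrable (fun x =>
        jac Ω v x i j * jac Ω v x i j + jac Ω v x i j * jac Ω v x j i) (vol Ω) :=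
      fun i j => (hint i j i j).add (hint i j j i)
    rw [integral_finsetSum _ fun i _ => integrable_finsetSum _ fun j _ => hint' i j, ← Finset.sum_add_distrib]
    refine Finset.sum_congr rfl fun i _ => ?_
    rw [integral_finsetSum _ fun j _ => hint' i j, ← Finset.sum_add_distrib]
    exact Finset.sum_congr rfl fun j _ => integral_add (hint _ _ _ _) (hint _ _ _ _)
  rw [e2, ← e1]
  have : 0 ≤ ∫ x in Ω, dvg Ω v x ^ 2 := integral_nonneg fun _ => sq_nonneg _
  linarith

/-- Poincaré for each component, then Korn. The factor `d` comes from Cauchy–Schwarz on the sum of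
partial derivatives, the factor `2` from Korn, and `+ 1` makes the constant positive. -/
theorem MemH10Vec.exists_lpNorm_sq_le (hd : d = 2 ∨ d = 3) (hΩ : IsOpen Ω)
    (hb : Bornology.IsBounded Ω) :
    ∃ C : ℝ, 0 < C ∧ ∀ v : E d → E d, MemH10Vec Ω v →
      lpNorm v 2 (vol Ω) ^ 2 ≤ C * ∫ x in Ω, contr (strain Ω v x) (strain Ω v x) := by
  obtain ⟨C, hC, hP⟩ := MemH10.exists_lpNorm_two_le (Ω := Ω) hd hΩ hb
  refine ⟨C ^ 2 * d * 2 + 1, by positivity, fun v hv => ?_⟩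
  have hJ := hv.memH1Vec.memLp_jac hΩ
  have h1 : lpNorm v 2 (vol Ω) ^ 2 = ∑ i, lpNorm (fun x => v x i) 2 (vol Ω) ^ 2 := by
    rw [lpNorm_two_sq hv.memH1Vec.memLp.1]
    simp only [EuclideanSpace.norm_sq_eq]
    rw [integral_finsetSum]
    · exact Finset.sum_congr rfl fun i _ => (lpNorm_two_sq (hv i).1.1.1).symm
    · intro i _
      simpa using (hv i).1.1.integrable_sq
  have h2 : ∀ i, lpNorm (fun x => v x i) 2 (vol Ω) ^ 2 ≤
      C ^ 2 * d * ∑ j, ∫ x in Ω, jac Ω v x i j ^ 2 := by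
    intro i
    calc lpNorm (fun x => v x i) 2 (vol Ω) ^ 2
        ≤ (C * ∑ j, lpNorm (fun x => jac Ω v x i j) 2 (vol Ω)) ^ 2 :=
          pow_le_pow_left₀ lpNorm_nonneg (hP _ (hv i)) 2
      _ = C ^ 2 * (∑ j, lpNorm (fun x => jac Ω v x i j) 2 (vol Ω)) ^ 2 := mul_pow _ _ _
      _ ≤ C ^ 2 * (d * ∑ j, lpNorm (fun x => jac Ω v x i j) 2 (vol Ω) ^ 2) := by
          refine mul_le_mul_of_nonneg_left ?_ (sq_nonneg C)
          simpa using sq_sum_le_card_mul_sum_sq (s := Finset.univ)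
            (f := fun j => lpNorm (fun x => jac Ω v x i j) 2 (vol Ω))
      _ = _ := by
          rw [mul_assoc]
          congr 2
          refine Finset.sum_congr rfl fun j _ => ?_
          rw [lpNorm_two_sq (hJ i j).1]
          simp only [Real.norm_eq_abs, sq_abs]
  have h3 := hv.sum_integral_jac_sq_le hd hΩ hb
  have h4 : 0 ≤ ∫ x in Ω, contr (strain Ω v x) (strain Ω v x) :=
    integral_nonneg fun _ => contr_self_nonneg _
  calc lpNorm v 2 (vol Ω) ^ 2
      ≤ ∑ i, C ^ 2 * d * ∑ j, ∫ x in Ω, jac Ω v x i j ^ 2 := by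
        rw [h1]
        exact Finset.sum_le_sum fun i _ => h2 i
    _ = C ^ 2 * d * ∑ i, ∑ j, ∫ x in Ω, jac Ω v x i j ^ 2 := by rw [Finset.mul_sum]
    _ ≤ C ^ 2 * d * (2 * ∫ x in Ω, contr (strain Ω v x) (strain Ω v x)) := by gcongr
    _ ≤ _ := by linarith

/-! ### Integrals with known values -/

theorem integrable_mul_of_top {α : Type*} [MeasurableSpace α] {μ : Measure α} {f g : α → ℝ}
    (hf : MemLp f ∞ μ) (hg : Integrable g μ) : Integrable (fun x => f x * g x) μ :=
  memLp_one_iff_integrable.1 (memLp_mul_of_top hf (memLp_one_iff_integrable.2 hg))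

/-- `f` is integrable with integral `c`. -/
def IntegralEq {α : Type*} [MeasurableSpace α] (μ : Measure α) (f : α → ℝ) (c : ℝ) : Prop :=
  Integrable f μ ∧ ∫ x, f x ∂μ = c

namespace IntegralEq

variable {α : Type*} [MeasurableSpace α] {μ : Measure α} {f g : α → ℝ} {a b : ℝ}

theorem of_integrable (hf : Integrable f μ) : IntegralEq μ f (∫ x, f x ∂μ) := ⟨hf, rfl⟩

theorem add (hf : IntegralEq μ f a) (hg : IntegralEq μ g b) :
    IntegralEq μ (fun x => f x + g x) (a + b) :=
  ⟨hf.1.add hg.1, by rw [integral_add hf.1 hg.1, hf.2, hg.2]⟩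

theorem sub (hf : IntegralEq μ f a) (hg : IntegralEq μ g b) :
    IntegralEq μ (fun x => f x - g x) (a - b) :=
  ⟨hf.1.sub hg.1, by rw [integral_sub hf.1 hg.1, hf.2, hg.2]⟩

theorem const_mul (hf : IntegralEq μ f a) (c : ℝ) : IntegralEq μ (fun x => c * f x) (c * a) :=
  ⟨hf.1.const_mul c, by rw [integral_const_mul, hf.2]⟩

theorem sum {ι : Type*} {s : Finset ι} {F : ι → α → ℝ} {A : ι → ℝ}
    (h : ∀ i ∈ s, IntegralEq μ (F i) (A i)) :
    IntegralEq μ (fun x => ∑ i ∈ s, F i x) (∑ i ∈ s, A i) :=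
  ⟨integrable_finsetSum _ fun i hi => (h i hi).1, by
    rw [integral_finsetSum _ fun i hi => (h i hi).1]
    exact Finset.sum_congr rfl fun i hi => (h i hi).2⟩

theorem mono_ae (hf : IntegralEq μ f a) (hg : IntegralEq μ g b) (h : ∀ᵐ x ∂μ, f x ≤ g x) :
    a ≤ b := by
  rw [← hf.2, ← hg.2]
  exact integral_mono_ae hf.1 hg.1 h

end IntegralEq

/-! ### One step of the scheme -/

/-- The regularity and the equations of one time step. -/
structure IsStep (Ω : Set (E d)) (η : ℝ → ℝ) (τ lam nub lamb : ℝ)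
    (ρ p ρ' R' p' : E d → ℝ) (m u m' u' f' : E d → E d) : Prop where
  density_mem : MemW1 Ω ∞ ρ
  density_mem' : MemW1 Ω ∞ ρ'
  momentum_mem : MemH10Vec Ω m
  momentum_mem' : MemH10Vec Ω m'
  velocity_mem : MemH10Vec Ω u
  velocity_mem' : MemH10Vec Ω u'
  pressure_mem : MemLp p 2 (vol Ω)
  source_mem : MemLp f' 2 (vol Ω)
  viscosity_mem : MemLp (fun x => η (ρ' x)) ∞ (vol Ω)
  momentum_eq : ∀ᵐ x ∂(vol Ω), m x = ρ x • u x
  momentum_eq' : ∀ᵐ x ∂(vol Ω), m' x = ρ' x • u' x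
  density_step : DensityStep Ω τ ρ ρ' R' u
  momentum_step : MomentumStep Ω η τ lam nub lamb ρ p ρ' R' m u m' u' f'
  pressure_step : ∀ᵐ x ∂(vol Ω), p' x = p x - lam * dvg Ω u' x

/-- The zeroth-order part of the momentum equation. -/
noncomputable def forceTerm (Ω : Set (E d)) (τ : ℝ) (ρ R' : E d → ℝ) (m u m' u' f' : E d → E d)
    (i : Fin d) (x : E d) : ℝ :=
  (1 / τ) * (m' x i - m x i) - 1 / 2 * ρ x * dvg Ω u x * u' x i - 1 / 2 * R' x * u' x i - f' x i

/-- The flux in the momentum equation. -/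
noncomputable def fluxTerm (Ω : Set (E d)) (η : ℝ → ℝ) (lam nub lamb : ℝ) (ρ p ρ' : E d → ℝ)
    (u m' u' : E d → E d) (i j : Fin d) (x : E d) : ℝ :=
  2 * nub * strain Ω (fun y => m' y - ρ' y • u y) x i j + 2 * η (ρ' x) * strain Ω u x i j
    + (if j = i then lamb * dvg Ω (fun y => m' y - ρ' y • u y) x + lam * dvg Ω u x - p x else 0)
    - ρ x * (u' x i * u x j)

theorem IsTest.smul_stdVec {φ : E d → ℝ} (hφ : IsTest Ω φ) (i : Fin d) :
    IsTest Ω (fun x => φ x • (stdVec i : E d)) :=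
  ⟨hφ.1.smul contDiff_const, hφ.2.1.smul_right, (tsupport_smul_subset_left _ _).trans hφ.2.2⟩

theorem testJac_smul_stdVec {φ : E d → ℝ} (hφ : IsTest Ω φ) (i k l : Fin d) (x : E d) :
    testJac (fun x => φ x • (stdVec i : E d)) x k l =
      if k = i then fderiv ℝ φ x (stdVec l) else 0 := by
  simp only [testJac, Matrix.of_apply]
  rw [fderiv_smul_const (hφ.differentiable x)]
  simp [stdVec]

theorem contr_testJac_smul_stdVec {φ : E d → ℝ} (hφ : IsTest Ω φ) (i : Fin d) (x : E d)
    (S : Matrix (Fin d) (Fin d) ℝ) :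
    contr S (testJac (fun x => φ x • (stdVec i : E d)) x) =
      ∑ j, S i j * fderiv ℝ φ x (stdVec j) := by
  simp only [contr, testJac_smul_stdVec hφ]
  rw [Finset.sum_eq_single i (fun k _ hk => by simp [hk]) (by simp)]
  simp

theorem testDvg_smul_stdVec {φ : E d → ℝ} (hφ : IsTest Ω φ) (i : Fin d) (x : E d) :
    testDvg (fun x => φ x • (stdVec i : E d)) x = fderiv ℝ φ x (stdVec i) := by
  have h : testDvg (fun x => φ x • (stdVec i : E d)) x =
      ∑ k, testJac (fun x => φ x • (stdVec i : E d)) x k k := rfl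
  simp [h, testJac_smul_stdVec hφ]

theorem inner_smul_stdVec (w : E d) (c : ℝ) (i : Fin d) :
    inner ℝ w (c • (stdVec i : E d)) = w i * c := by
  rw [inner_smul_right, stdVec, EuclideanSpace.inner_single_right]
  simp [mul_comm]

namespace IsStep

variable {η : ℝ → ℝ} {τ lam nub lamb : ℝ} {ρ p ρ' R' p' : E d → ℝ} {m u m' u' f' : E d → E d}

/-- Since `m' - ρ'u = ρ'(u' - u)` almost everywhere, this is the product rule. The term with the
derivative of `ρ'` is the one that the time step conditions must control. -/
theorem weakDeriv_flux_ae_eq (hd : d = 2 ∨ d = 3) (hΩ : IsOpen Ω) (hb : Bornology.IsBounded Ω)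
    (h : IsStep Ω η τ lam nub lamb ρ p ρ' R' p' m u m' u' f') (i j : Fin d) :
    weakDeriv Ω j (fun y => (m' y - ρ' y • u y) i) =ᵐ[vol Ω] fun x =>
      ρ' x * (jac Ω u' x i j - jac Ω u x i j) + weakDeriv Ω j ρ' x * (u' x i - u x i) := by
  have h1 := (h.momentum_mem' i).1.isWeakDeriv j
  have h2 := IsWeakDeriv.mul_of_memW1_of_memH10 hd hΩ hb h.density_mem' (h.velocity_mem i) j
  have h3 := IsWeakDeriv.mul_of_memW1_of_memH10 hd hΩ hb h.density_mem' (h.velocity_mem' i) j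
  have h4 := h1.ae_eq hΩ h3 (h.momentum_eq'.mono fun x hx => by simp [hx])
  have h5 := (h1.sub h2).weakDeriv_ae_eq hΩ
  have h6 : (fun y => (m' y - ρ' y • u y) i) = fun y => m' y i - ρ' y * u y i := by
    ext y
    simp
  rw [h6]
  filter_upwards [h4, h5] with x hx4 hx5
  rw [hx5, hx4]
  simp only [jac, Matrix.of_apply]
  ring

theorem jac_flux_ae_eq (hd : d = 2 ∨ d = 3) (hΩ : IsOpen Ω) (hb : Bornology.IsBounded Ω)
    (h : IsStep Ω η τ lam nub lamb ρ p ρ' R' p' m u m' u' f') :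
    ∀ᵐ x ∂(vol Ω), jac Ω (fun y => m' y - ρ' y • u y) x =
      ρ' x • (jac Ω u' x - jac Ω u x) +
        Matrix.vecMulVec ((fun i => u' x i) - fun i => u x i) (fun j => weakDeriv Ω j ρ' x) := by
  have h1 : ∀ᵐ x ∂(vol Ω), ∀ i j, weakDeriv Ω j (fun y => (m' y - ρ' y • u y) i) x =
      ρ' x * (jac Ω u' x i j - jac Ω u x i j) + weakDeriv Ω j ρ' x * (u' x i - u x i) :=
    ae_all_iff.2 fun i => ae_all_iff.2 fun j => h.weakDeriv_flux_ae_eq hd hΩ hb i j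
  filter_upwards [h1] with x hx
  ext i j
  have e : jac Ω (fun y => m' y - ρ' y • u y) x i j =
    weakDeriv Ω j (fun y => (m' y - ρ' y • u y) i) x := rfl
  rw [e, hx i j]
  simp [Matrix.vecMulVec_apply, mul_comm]

theorem memLp_jac_flux (hd : d = 2 ∨ d = 3) (hΩ : IsOpen Ω) (hb : Bornology.IsBounded Ω)
    (h : IsStep Ω η τ lam nub lamb ρ p ρ' R' p' m u m' u' f') (i j : Fin d) :
    MemLp (fun x => jac Ω (fun y => m' y - ρ' y • u y) x i j) 2 (vol Ω) :=
  (memLp_congr_ae (h.weakDeriv_flux_ae_eq hd hΩ hb i j)).2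
    ((memLp_mul_of_top h.density_mem'.1 ((h.velocity_mem'.memH1Vec.memLp_jac hΩ i j).sub
      (h.velocity_mem.memH1Vec.memLp_jac hΩ i j))).add
    (memLp_mul_of_top (h.density_mem'.memLp_weakDeriv hΩ j)
      ((h.velocity_mem' i).1.1.sub (h.velocity_mem i).1.1)))

theorem memLp_strain_flux (hd : d = 2 ∨ d = 3) (hΩ : IsOpen Ω) (hb : Bornology.IsBounded Ω)
    (h : IsStep Ω η τ lam nub lamb ρ p ρ' R' p' m u m' u' f') (i j : Fin d) :
    MemLp (fun x => strain Ω (fun y => m' y - ρ' y • u y) x i j) 2 (vol Ω) :=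
  ((h.memLp_jac_flux hd hΩ hb i j).add (h.memLp_jac_flux hd hΩ hb j i)).const_mul (1 / 2)

theorem memLp_dvg_flux (hd : d = 2 ∨ d = 3) (hΩ : IsOpen Ω) (hb : Bornology.IsBounded Ω)
    (h : IsStep Ω η τ lam nub lamb ρ p ρ' R' p' m u m' u' f') :
    MemLp (dvg Ω (fun y => m' y - ρ' y • u y)) 2 (vol Ω) :=
  memLp_finsetSum _ fun i _ => h.memLp_jac_flux hd hΩ hb i i

theorem residual_ae_eq (h : IsStep Ω η τ lam nub lamb ρ p ρ' R' p' m u m' u' f') :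
    ∀ᵐ x ∂(vol Ω), (ρ' x - ρ x) / τ + ∑ j, u x j * weakDeriv Ω j ρ x = R' x := by
  filter_upwards [h.density_step] with x hx
  rw [← hx]
  simp [grad, PiLp.inner_apply, mul_comm]

/-- No regularity of the residual is assumed; the density equation provides it, because `u` is in
`L⁴` and `ρ` is in `W^{1,∞}`. -/
theorem memLp_residual (hd : d = 2 ∨ d = 3) (hΩ : IsOpen Ω) (hb : Bornology.IsBounded Ω)
    (h : IsStep Ω η τ lam nub lamb ρ p ρ' R' p' m u m' u' f') : MemLp R' 4 (vol Ω) := by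
  have hfin := isFiniteMeasure_vol hb
  refine (memLp_congr_ae h.residual_ae_eq).1 (MemLp.add ?_ (memLp_finsetSum _ fun j _ => ?_))
  · simp only [div_eq_mul_inv]
    exact ((h.density_mem'.1.sub h.density_mem.1).mul_const τ⁻¹).mono_exponent le_top
  · exact memLp_mul_of_holder (p := 4) (q := ∞) inferInstance
      ((h.velocity_mem j).memLp_four hd hΩ hb) (h.density_mem.memLp_weakDeriv hΩ j)

/-- The exponent is dictated by `ρ (div u) u'`, a product of an `L²` and an `L⁴` function; `4/3` is
dual to the Sobolev exponent `4`. -/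
theorem memLp_forceTerm (hd : d = 2 ∨ d = 3) (hΩ : IsOpen Ω) (hb : Bornology.IsBounded Ω)
    (h : IsStep Ω η τ lam nub lamb ρ p ρ' R' p' m u m' u' f') (i : Fin d) :
    MemLp (forceTerm Ω τ ρ R' m u m' u' f' i) (4 / 3) (vol Ω) := by
  have hu' := (h.velocity_mem' i).memLp_four hd hΩ hb
  have hf : MemLp (fun x => f' x i) 2 (vol Ω) := memLp_piLp_iff.1 h.source_mem i
  have h1 : MemLp (fun x => 1 / 2 * ρ x * dvg Ω u x) 2 (vol Ω) :=
    memLp_mul_of_top (h.density_mem.1.const_mul (1 / 2)) (h.velocity_mem.memH1Vec.memLp_dvg hΩ)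
  have h2 : MemLp (fun x => 1 / 2 * R' x) 4 (vol Ω) := (h.memLp_residual hd hΩ hb).const_mul _
  refine ((MemLp.sub ?_ ?_).sub ?_).sub (memLp_four_thirds_of_two hb hf)
  · exact memLp_four_thirds_of_two hb
      (((h.momentum_mem' i).1.1.sub (h.momentum_mem i).1.1).const_mul _)
  · have := memLp_mul_of_holder holderTriple_four_two hu' h1
    simpa only [mul_comm] using this
  · exact memLp_four_thirds_of_two hb (memLp_mul_of_holder holderTriple_four_four_two h2 hu')

theorem memLp_velocity_mul (hd : d = 2 ∨ d = 3) (hΩ : IsOpen Ω) (hb : Bornology.IsBounded Ω)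
    (h : IsStep Ω η τ lam nub lamb ρ p ρ' R' p' m u m' u' f') (i j : Fin d) :
    MemLp (fun x => u' x i * u x j) 2 (vol Ω) :=
  memLp_mul_of_holder holderTriple_four_four_two ((h.velocity_mem' i).memLp_four hd hΩ hb)
    ((h.velocity_mem j).memLp_four hd hΩ hb)

theorem memLp_fluxTerm (hd : d = 2 ∨ d = 3) (hΩ : IsOpen Ω) (hb : Bornology.IsBounded Ω)
    (h : IsStep Ω η τ lam nub lamb ρ p ρ' R' p' m u m' u' f') (i j : Fin d) :
    MemLp (fluxTerm Ω η lam nub lamb ρ p ρ' u m' u' i j) 2 (vol Ω) := by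
  have h1 : MemLp (fun x => 2 * nub * strain Ω (fun y => m' y - ρ' y • u y) x i j) 2 (vol Ω) :=
    (h.memLp_strain_flux hd hΩ hb i j).const_mul _
  have h2 : MemLp (fun x => 2 * η (ρ' x) * strain Ω u x i j) 2 (vol Ω) :=
    memLp_mul_of_top (h.viscosity_mem.const_mul 2) (h.velocity_mem.memH1Vec.memLp_strain hΩ i j)
  have h3 : MemLp (fun x => if j = i then lamb * dvg Ω (fun y => m' y - ρ' y • u y) x
      + lam * dvg Ω u x - p x else 0) 2 (vol Ω) := by
    by_cases hij : j = i
    · simp only [hij, if_true]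
      exact (((h.memLp_dvg_flux hd hΩ hb).const_mul _).add
        ((h.velocity_mem.memH1Vec.memLp_dvg hΩ).const_mul _)).sub h.pressure_mem
    · simp [hij]
  have h4 : MemLp (fun x => ρ x * (u' x i * u x j)) 2 (vol Ω) :=
    memLp_mul_of_top h.density_mem.1 (h.memLp_velocity_mul hd hΩ hb i j)
  exact ((h1.add h2).add h3).sub h4

/-- The `i`-th component of the momentum equation, tested with a scalar test function. -/
theorem integral_isTest_eq_zero (hd : d = 2 ∨ d = 3) (hΩ : IsOpen Ω) (hb : Bornology.IsBounded Ω)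
    (h : IsStep Ω η τ lam nub lamb ρ p ρ' R' p' m u m' u' f') (i : Fin d) {φ : E d → ℝ}
    (hφ : IsTest Ω φ) :
    ∫ x in Ω, (forceTerm Ω τ ρ R' m u m' u' f' i x * φ x +
      ∑ j, fluxTerm Ω η lam nub lamb ρ p ρ' u m' u' i j x * fderiv ℝ φ x (stdVec j)) = 0 := by
  have hmom := h.momentum_step _ (hφ.smul_stdVec i)
  simp only [contr_testJac_smul_stdVec hφ, testDvg_smul_stdVec hφ, inner_smul_stdVec,
    PiLp.smul_apply, PiLp.sub_apply, smul_eq_mul, Matrix.of_apply] at hmom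
  have hφ2 := hφ.memLp 2
  have hdφ := fun j => (hφ.fderiv_apply (stdVec j)).memLp 2
  have hu'φ : MemLp (fun x => u' x i * φ x) 2 (vol Ω) :=
    memLp_mul_of_holder (p := 2) (q := ∞) inferInstance (h.velocity_mem' i).1.1 (hφ.memLp ∞)
  have i1 : Integrable (fun x => 1 / τ * (m' x i - m x i) * φ x) (vol Ω) :=
    integrable_mul_two (((h.momentum_mem' i).1.1.sub (h.momentum_mem i).1.1).const_mul _) hφ2
  have i2 : Integrable (fun x => 2 * nub * ∑ j, strain Ω (fun y => m' y - ρ' y • u y) x i j *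
      fderiv ℝ φ x (stdVec j)) (vol Ω) :=
    (integrable_finsetSum _ fun j _ =>
      integrable_mul_two (h.memLp_strain_flux hd hΩ hb i j) (hdφ j)).const_mul _
  have i3 : Integrable (fun x => 2 * η (ρ' x) * ∑ j, strain Ω u x i j *
      fderiv ℝ φ x (stdVec j)) (vol Ω) :=
    integrable_mul_of_top (h.viscosity_mem.const_mul 2) (integrable_finsetSum _ fun j _ =>
      integrable_mul_two (h.velocity_mem.memH1Vec.memLp_strain hΩ i j) (hdφ j))
  have i4 : Integrable (fun x => lamb * dvg Ω (fun y => m' y - ρ' y • u y) x *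
      fderiv ℝ φ x (stdVec i)) (vol Ω) :=
    integrable_mul_two ((h.memLp_dvg_flux hd hΩ hb).const_mul _) (hdφ i)
  have i5 : Integrable (fun x => lam * dvg Ω u x * fderiv ℝ φ x (stdVec i)) (vol Ω) :=
    integrable_mul_two ((h.velocity_mem.memH1Vec.memLp_dvg hΩ).const_mul _) (hdφ i)
  have i6 : Integrable (fun x => p x * fderiv ℝ φ x (stdVec i)) (vol Ω) :=
    integrable_mul_two h.pressure_mem (hdφ i)
  have i7 : Integrable (fun x => ρ x * ∑ j, u' x i * u x j * fderiv ℝ φ x (stdVec j)) (vol Ω) :=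
    integrable_mul_of_top h.density_mem.1 (integrable_finsetSum _ fun j _ =>
      integrable_mul_two (h.memLp_velocity_mul hd hΩ hb i j) (hdφ j))
  have i8 : Integrable (fun x => 1 / 2 * ρ x * dvg Ω u x * (u' x i * φ x)) (vol Ω) :=
    integrable_mul_two (memLp_mul_of_top (h.density_mem.1.const_mul (1 / 2))
      (h.velocity_mem.memH1Vec.memLp_dvg hΩ)) hu'φ
  have i9 : Integrable (fun x => 1 / 2 * R' x * (u' x i * φ x)) (vol Ω) :=
    integrable_mul_two ((memLp_two_of_four hb (h.memLp_residual hd hΩ hb)).const_mul _) hu'φ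
  have i10 : Integrable (fun x => f' x i * φ x) (vol Ω) :=
    integrable_mul_two (memLp_piLp_iff.1 h.source_mem i) hφ2
  have key := ((((((((((IntegralEq.of_integrable i1).add (.of_integrable i2)).add
    (.of_integrable i3)).add (.of_integrable i4)).add (.of_integrable i5)).sub
    (.of_integrable i6)).sub (.of_integrable i7)).sub (.of_integrable i8)).sub
    (.of_integrable i9)).sub (.of_integrable i10)).2
  rw [hmom, sub_self] at key
  refine Eq.trans (integral_congr_ae (.of_forall fun x => ?_)) key
  simp only [forceTerm, fluxTerm, add_mul, sub_mul, ite_mul, zero_mul, Finset.sum_add_distrib,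
    Finset.sum_sub_distrib, Finset.sum_ite_eq', Finset.mem_univ, if_true, Finset.mul_sum]
  simp only [mul_assoc]
  ring

theorem integral_velocity_eq_zero (hd : d = 2 ∨ d = 3) (hΩ : IsOpen Ω)
    (hb : Bornology.IsBounded Ω) (h : IsStep Ω η τ lam nub lamb ρ p ρ' R' p' m u m' u' f')
    (i : Fin d) :
    ∫ x in Ω, (forceTerm Ω τ ρ R' m u m' u' f' i x * u' x i +
      ∑ j, fluxTerm Ω η lam nub lamb ρ p ρ' u m' u' i j x * jac Ω u' x i j) = 0 :=
  (h.velocity_mem' i).integral_eq_zero_of_forall_isTest hd hΩ hb (h.memLp_forceTerm hd hΩ hb i)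
    (h.memLp_fluxTerm hd hΩ hb i) fun _ hφ => h.integral_isTest_eq_zero hd hΩ hb i hφ

end IsStep

theorem integral_sum_mul_le_lpNorm {f v : E d → E d} (hf : MemLp f 2 (vol Ω))
    (hv : MemLp v 2 (vol Ω)) :
    ∫ x in Ω, ∑ i, f x i * v x i ≤ lpNorm f 2 (vol Ω) * lpNorm v 2 (vol Ω) := by
  have h1 : Integrable (fun x => ‖f x‖ * ‖v x‖) (vol Ω) := integrable_mul_two hf.norm hv.norm
  have h2 : Integrable (fun x => ∑ i, f x i * v x i) (vol Ω) :=
    integrable_finsetSum _ fun i _ =>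
      integrable_mul_two (memLp_piLp_iff.1 hf i) (memLp_piLp_iff.1 hv i)
  calc ∫ x in Ω, ∑ i, f x i * v x i ≤ ∫ x in Ω, ‖f x‖ * ‖v x‖ := by
        refine integral_mono h2 h1 fun x => ?_
        have := real_inner_le_norm (f x) (v x)
        simpa [PiLp.inner_apply, mul_comm] using this
    _ ≤ |∫ x in Ω, ‖f x‖ * ‖v x‖| := le_abs_self _
    _ ≤ lpNorm (fun x => ‖f x‖) 2 (vol Ω) * lpNorm (fun x => ‖v x‖) 2 (vol Ω) :=
        abs_integral_mul_le_lpNorm inferInstance hf.norm hv.norm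
    _ = _ := by rw [lpNorm_norm hf.1, lpNorm_norm hv.1]

namespace MemH1Vec

variable {v : E d → E d} {w : E d → ℝ}

theorem integralEq_normVec (hv : MemH1Vec Ω v) (hw : MemLp w ∞ (vol Ω))
    (hw0 : ∀ᵐ x ∂(vol Ω), 0 ≤ w x) :
    IntegralEq (vol Ω) (fun x => w x * ∑ i, v x i ^ 2) (normVec Ω w v ^ 2) :=
  ⟨integrable_mul_of_top hw hv.integrable_sum_sq, (hv.normVec_sq hw.1 hw0).symm⟩

theorem integralEq_normStrain (hΩ : IsOpen Ω) (hv : MemH1Vec Ω v) (hw : MemLp w ∞ (vol Ω))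
    (hw0 : ∀ᵐ x ∂(vol Ω), 0 ≤ w x) :
    IntegralEq (vol Ω) (fun x => w x * contr (symPart (jac Ω v x)) (symPart (jac Ω v x)))
      (normStrain Ω w v ^ 2) :=
  ⟨integrable_mul_of_top hw (hv.integrable_contr_strain hΩ), (hv.normStrain_sq hΩ hw.1 hw0).symm⟩

theorem integralEq_normDvg (hΩ : IsOpen Ω) (hv : MemH1Vec Ω v) (hw : MemLp w ∞ (vol Ω))
    (hw0 : ∀ᵐ x ∂(vol Ω), 0 ≤ w x) :
    IntegralEq (vol Ω) (fun x => w x * (∑ i, jac Ω v x i i) ^ 2) (normDvg Ω w v ^ 2) :=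
  ⟨integrable_mul_of_top hw (hv.integrable_dvg_sq hΩ), (hv.normDvg_sq hΩ hw.1 hw0).symm⟩

end MemH1Vec

theorem integralEq_lpNorm_sq {g : E d → ℝ} (hg : MemLp g 2 (vol Ω)) :
    IntegralEq (vol Ω) (fun x => g x ^ 2) (lpNorm g 2 (vol Ω) ^ 2) :=
  ⟨hg.integrable_sq, by rw [lpNorm_two_sq hg.1]; simp only [Real.norm_eq_abs, sq_abs]⟩

namespace IsStep

variable {η : ℝ → ℝ} {τ lam nub lamb : ℝ} {ρ p ρ' R' p' : E d → ℝ} {m u m' u' f' : E d → E d}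

theorem integralEq_momentum (hd : d = 2 ∨ d = 3) (hΩ : IsOpen Ω) (hb : Bornology.IsBounded Ω)
    (h : IsStep Ω η τ lam nub lamb ρ p ρ' R' p' m u m' u' f') (i : Fin d) :
    IntegralEq (vol Ω) (fun x => forceTerm Ω τ ρ R' m u m' u' f' i x * u' x i +
      ∑ j, fluxTerm Ω η lam nub lamb ρ p ρ' u m' u' i j x * jac Ω u' x i j) 0 :=
  ⟨(integrable_mul_four_thirds (h.memLp_forceTerm hd hΩ hb i)
      ((h.velocity_mem' i).memLp_four hd hΩ hb)).add
    (integrable_finsetSum _ fun j _ => integrable_mul_two (h.memLp_fluxTerm hd hΩ hb i j)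
      (h.velocity_mem'.memH1Vec.memLp_jac hΩ i j)), h.integral_velocity_eq_zero hd hΩ hb i⟩

/-- Added to the tested momentum equation with weight `τ`, this zero integral cancels the convection
term and half of the density-weighted divergence. -/
theorem integralEq_convection (hd : d = 2 ∨ d = 3) (hΩ : IsOpen Ω) (hb : Bornology.IsBounded Ω)
    (h : IsStep Ω η τ lam nub lamb ρ p ρ' R' p' m u m' u' f') (i j : Fin d) :
    IntegralEq (vol Ω) (fun x => 2 * (ρ x * u x j * u' x i * jac Ω u' x i j) +
      (ρ x * jac Ω u x j j + weakDeriv Ω j ρ x * u x j) * u' x i ^ 2) 0 := by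
  have hv := (h.velocity_mem' i).memLp_four hd hΩ hb
  have hw := (h.velocity_mem j).memLp_four hd hΩ hb
  refine ⟨Integrable.add ?_ ?_, integral_weakDeriv_mul_mul_sq_eq_zero hd hΩ hb h.density_mem
    (h.velocity_mem' i) (h.velocity_mem j) j⟩
  · exact (integrable_mul_two (memLp_mul_of_holder holderTriple_four_four_two
      (memLp_mul_of_top h.density_mem.1 hw) hv)
      (h.velocity_mem'.memH1Vec.memLp_jac hΩ i j)).const_mul 2
  · simp only [sq (u' _ i)]
    exact integrable_mul_two ((memLp_mul_of_top h.density_mem.1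
      (h.velocity_mem.memH1Vec.memLp_jac hΩ j j)).add
      (memLp_mul_of_top (h.density_mem.memLp_weakDeriv hΩ j) (h.velocity_mem j).1.1))
      (memLp_mul_of_holder holderTriple_four_four_two hv hv)

/-- Integrates the pointwise inequality: the tested momentum equation and the convection identity
contribute zero, and the two Young remainders are absorbed by one of the two copies of `τ‖√η
ε(u')‖²`. -/
theorem energy_le (hd : d = 2 ∨ d = 3) (hΩ : IsOpen Ω) (hb : Bornology.IsBounded Ω)
    (h : IsStep Ω η τ lam nub lamb ρ p ρ' R' p' m u m' u' f') {γ₁ γ₂ c₃ : ℝ} (hτ : 0 < τ)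
    (hlam : 0 < lam) (hr : ∀ᵐ x ∂(vol Ω), 0 ≤ ρ x) (hr' : ∀ᵐ x ∂(vol Ω), 0 ≤ ρ' x)
    (he : ∀ᵐ x ∂(vol Ω), 0 ≤ η (ρ' x))
    (h1 : ∀ᵐ x ∂(vol Ω), η (ρ' x) ≤ nub * ρ' x) (h2 : ∀ᵐ x ∂(vol Ω), lam ≤ lamb * ρ' x)
    (h3 : ∀ᵐ x ∂(vol Ω), nub * (ρ' x - ρ x) ≤ η (ρ' x))
    (h4 : ∀ᵐ x ∂(vol Ω), lamb * (ρ' x - ρ x) ≤ lam)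
    (h5 : ∀ᵐ x ∂(vol Ω),
      8 * τ * nub ^ 2 * ∑ j, weakDeriv Ω j ρ' x ^ 2 ≤ γ₁ ^ 2 * (ρ x * η (ρ' x)))
    (h6 : ∀ᵐ x ∂(vol Ω),
      2 * τ * lamb ^ 2 * ∑ j, weakDeriv Ω j ρ' x ^ 2 ≤ γ₂ ^ 2 * (ρ x * η (ρ' x)))
    (hγ₁ : γ₁ ^ 2 ≤ 1 / 2) (hγ₂ : γ₂ ^ 2 * c₃ ^ 2 ≤ 1 / 2)
    (hc₃ : normDvg Ω (fun x => η (ρ' x)) u' ≤ c₃ * normStrain Ω (fun x => η (ρ' x)) u') :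
    normVec Ω ρ' u' ^ 2 + 2 * τ * nub * normStrain Ω ρ' u' ^ 2 + τ * lamb * normDvg Ω ρ' u' ^ 2
        + τ / lam * lpNorm p' 2 (vol Ω) ^ 2 + τ * normStrain Ω (fun x => η (ρ' x)) u' ^ 2
      ≤ normVec Ω ρ u ^ 2 + 2 * τ * nub * normStrain Ω ρ u ^ 2 + τ * lamb * normDvg Ω ρ u ^ 2
        + τ / lam * lpNorm p 2 (vol Ω) ^ 2
        + 2 * τ * lpNorm f' 2 (vol Ω) * lpNorm u' 2 (vol Ω) := by
  have hu := h.velocity_mem.memH1Vec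
  have hu' := h.velocity_mem'.memH1Vec
  have hp' : MemLp p' 2 (vol Ω) :=
    (memLp_congr_ae h.pressure_step).2 (h.pressure_mem.sub ((hu'.memLp_dvg hΩ).const_mul lam))
  have hρ := h.density_mem.1
  have hρ' := h.density_mem'.1
  have hη := h.viscosity_mem
  have hF : IntegralEq (vol Ω) (fun x => ∑ i, f' x i * u' x i)
      (∫ x in Ω, ∑ i, f' x i * u' x i) :=
    .of_integrable (integrable_finsetSum _ fun i _ =>
      integrable_mul_two (memLp_piLp_iff.1 h.source_mem i) (hu' i).1)
  have hX := IntegralEq.sum fun i (_ : i ∈ Finset.univ) => h.integralEq_momentum hd hΩ hb i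
  have hK := IntegralEq.sum fun i (_ : i ∈ Finset.univ) =>
    IntegralEq.sum fun j (_ : j ∈ Finset.univ) => h.integralEq_convection hd hΩ hb i j
  have hL := (((((hu'.integralEq_normVec hρ' hr').add
    ((hu'.integralEq_normStrain hΩ hρ' hr').const_mul (2 * τ * nub))).add
    ((hu'.integralEq_normDvg hΩ hρ' hr').const_mul (τ * lamb))).add
    ((integralEq_lpNorm_sq hp').const_mul (τ / lam))).add
    ((hu'.integralEq_normStrain hΩ hη he).const_mul (2 * τ)))
  have hR := (((((((((hu.integralEq_normVec hρ hr).add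
    ((hu.integralEq_normStrain hΩ hρ hr).const_mul (2 * τ * nub))).add
    ((hu.integralEq_normDvg hΩ hρ hr).const_mul (τ * lamb))).add
    ((integralEq_lpNorm_sq h.pressure_mem).const_mul (τ / lam))).add
    (hF.const_mul (2 * τ))).add (hX.const_mul (2 * τ))).add (hK.const_mul τ)).add
    ((hu'.integralEq_normStrain hΩ hη he).const_mul (γ₁ ^ 2 * τ))).add
    ((hu'.integralEq_normDvg hΩ hη he).const_mul (γ₂ ^ 2 * τ)))
  have key := hL.mono_ae hR (by
    filter_upwards [hr, he, h1, h2, h3, h4, h5, h6, h.momentum_eq, h.momentum_eq',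
      h.pressure_step, h.residual_ae_eq, h.jac_flux_ae_eq hd hΩ hb] with
      x xr xe x1 x2 x3 x4 x5 x6 xm xm' xp xR xJ
    have hD : dvg Ω (fun y => m' y - ρ' y • u y) x = ∑ k,
        (ρ' x * (jac Ω u' x k k - jac Ω u x k k) + (u' x k - u x k) * weakDeriv Ω k ρ' x) := by
      have e : dvg Ω (fun y => m' y - ρ' y • u y) x =
        ∑ k, jac Ω (fun y => m' y - ρ' y • u y) x k k := rfl
      rw [e, xJ]
      simp [Matrix.vecMulVec_apply]
    have hpt := pointwise_energy_le (U := fun i => u x i) (U' := fun i => u' x i)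
      (F := fun i => f' x i) (g := fun j => weakDeriv Ω j ρ' x)
      (a := fun j => weakDeriv Ω j ρ x) (G := jac Ω u x) (G' := jac Ω u' x)
      (p := p x) (p' := p' x) (r := ρ x) (r' := ρ' x) (e := η (ρ' x)) (R := R' x)
      (nub := nub) (lamb := lamb) (γ₁ := γ₁) (γ₂ := γ₂)
      hτ hlam xr xe xR xp x1 x2 x3 x4 x5 x6
    simp only [forceTerm, fluxTerm, strain_eq_symPart, hD, xJ, xm, xm', PiLp.smul_apply,
      smul_eq_mul, mul_assoc] at hpt ⊢
    exact hpt)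
  have hf := integral_sum_mul_le_lpNorm h.source_mem hu'.memLp
  have hf' := mul_le_mul_of_nonneg_left hf (by positivity : 0 ≤ 2 * τ)
  have hdv : normDvg Ω (fun x => η (ρ' x)) u' ^ 2 ≤
      c₃ ^ 2 * normStrain Ω (fun x => η (ρ' x)) u' ^ 2 := by
    rw [← mul_pow]
    exact pow_le_pow_left₀ lpNorm_nonneg hc₃ 2
  set S := normStrain Ω (fun x => η (ρ' x)) u' ^ 2
  have hS : 0 ≤ S := sq_nonneg _
  -- Each remainder takes at most half of `τ * S`; for the second, `c₃` converts the divergence into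
  -- the strain with the same weight `η(ρ')`.
  have k1 : γ₁ ^ 2 * τ * S ≤ 1 / 2 * (τ * S) := by
    rw [mul_assoc]
    exact mul_le_mul_of_nonneg_right hγ₁ (by positivity)
  have k2 : γ₂ ^ 2 * τ * normDvg Ω (fun x => η (ρ' x)) u' ^ 2 ≤ 1 / 2 * (τ * S) :=
    calc _ ≤ γ₂ ^ 2 * τ * (c₃ ^ 2 * S) := by gcongr
      _ = γ₂ ^ 2 * c₃ ^ 2 * (τ * S) := by ring
      _ ≤ _ := mul_le_mul_of_nonneg_right hγ₂ (by positivity)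
  simp only [Finset.sum_const_zero, mul_zero, add_zero] at key
  linarith

end IsStep

/-! ### From norm conditions to pointwise inequalities -/

/-- The lower bound `a` keeps the weighted gradient in `L^∞`, where `lpNorm` is a genuine essential
supremum and not the default value zero; squaring the pointwise bound then clears the weight. -/
theorem ae_mul_sum_sq_le_of_lpNorm_le (hΩ : IsOpen Ω) {τ κ γ a : ℝ} {w σ : E d → ℝ} (hτ : 0 ≤ τ)
    (ha : 0 < a) (hw : AEStronglyMeasurable w (vol Ω)) (haw : ∀ᵐ x ∂(vol Ω), a ≤ w x)
    (hσ : MemW1 Ω ∞ σ)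
    (hγ : √τ * lpNorm (fun x => (κ / √(w x)) • grad Ω σ x) ∞ (vol Ω) ≤ γ) :
    ∀ᵐ x ∂(vol Ω), τ * κ ^ 2 * ∑ j, weakDeriv Ω j σ x ^ 2 ≤ γ ^ 2 * w x := by
  have hc : MemLp (fun x => κ / √(w x)) ∞ (vol Ω) := by
    refine memLp_top_of_bound ?_ (|κ| / √a) (haw.mono fun x hx => ?_)
    · exact (aestronglyMeasurable_const.aemeasurable.div
        (aestronglyMeasurable_sqrt hw).aemeasurable).aestronglyMeasurable
    · rw [norm_div, Real.norm_eq_abs, Real.norm_of_nonneg (Real.sqrt_nonneg _)]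
      gcongr
  have hg : MemLp (grad Ω σ) ∞ (vol Ω) := memLp_piLp_iff.2 fun j => hσ.memLp_weakDeriv hΩ j
  have hcg : MemLp (fun x => (κ / √(w x)) • grad Ω σ x) ∞ (vol Ω) :=
    hg.smul (p := ∞) (hpqr := inferInstance) hc
  filter_upwards [ae_le_lpNorm_exponent_top hcg, haw] with x hx hax
  have hw0 : 0 < w x := ha.trans_le hax
  have h1 : √τ * ‖(κ / √(w x)) • grad Ω σ x‖ ≤ γ :=
    (mul_le_mul_of_nonneg_left hx (Real.sqrt_nonneg _)).trans hγ
  have h2 := pow_le_pow_left₀ (by positivity) h1 2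
  have h3 : ‖grad Ω σ x‖ ^ 2 = ∑ j, weakDeriv Ω j σ x ^ 2 := by
    simp [EuclideanSpace.norm_sq_eq, grad]
  rw [norm_smul, mul_pow, mul_pow, h3, Real.sq_sqrt hτ, Real.norm_eq_abs, sq_abs, div_pow,
    Real.sq_sqrt hw0.le] at h2
  calc τ * κ ^ 2 * ∑ j, weakDeriv Ω j σ x ^ 2
      = τ * (κ ^ 2 / w x * ∑ j, weakDeriv Ω j σ x ^ 2) * w x := by field_simp
    _ ≤ γ ^ 2 * w x := by gcongr

/-- The properties of a scheme solution that enter the energy estimate. -/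
theorem IsSchemeSolution.isStep {η : ℝ → ℝ} {τ lam a : ℝ} {ρ R p : ℕ → E d → ℝ}
    {m u f : ℕ → E d → E d} (h : IsSchemeSolution Ω η τ lam ρ R p m u f)
    (hf : ∀ n, MemLp (f n) 2 (vol Ω)) (ha : 0 < a) (haρ : ∀ n, ∀ᵐ x ∂(vol Ω), a ≤ ρ n x)
    (hη : ∀ n, MemLp (fun x => η (ρ n x)) ∞ (vol Ω)) (n : ℕ) :
    IsStep Ω η τ lam (nuBar Ω η (ρ 0)) (lamBar Ω lam (ρ 0)) (ρ n) (p n) (ρ (n + 1)) (R (n + 1))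
      (p (n + 1)) (m n) (u n) (m (n + 1)) (u (n + 1)) (f (n + 1)) := by
  have hm' : ∀ n, ∀ᵐ x ∂(vol Ω), m (n + 1) x = ρ (n + 1) x • u (n + 1) x := fun n => by
    filter_upwards [h.velocity_step n, haρ (n + 1)] with x hx hax
    have hpos : ρ (n + 1) x ≠ 0 := (ha.trans_le hax).ne'
    rw [hx, smul_smul, mul_one_div_cancel hpos, one_smul]
  -- At `n = 0` the relation is the initial condition; afterwards it is the velocity update,
  -- inverted since the density is positive.
  have hm : ∀ n, ∀ᵐ x ∂(vol Ω), m n x = ρ n x • u n x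
    | 0 => h.momentum_init
    | n + 1 => hm' n
  exact ⟨h.density_mem n, h.density_mem _, h.momentum_mem n, h.momentum_mem _, h.velocity_mem n,
    h.velocity_mem _, h.pressure_mem n, hf _, hη _, hm n, hm _, h.density_step n,
    h.momentum_step n, h.pressure_step n⟩

theorem nuBar_nonneg (η : ℝ → ℝ) (ρ₀ : E d → ℝ) : 0 ≤ nuBar Ω η ρ₀ :=
  mul_nonneg (by norm_num) lpNorm_nonneg

theorem lamBar_nonneg {lam : ℝ} (hlam : 0 ≤ lam) (ρ₀ : E d → ℝ) : 0 ≤ lamBar Ω lam ρ₀ :=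
  mul_nonneg (by positivity) lpNorm_nonneg

section Coefficients

variable {ρ₀ : E d → ℝ} {r : ℝ}

/-- The range lemma for `r ↦ η r / r`, which is continuous because the interval stays away from
zero. Of the factor `1.1` only `1.1 ≥ 1` enters. -/
theorem le_nuBar_mul (hΩ : IsOpen Ω) (hb : Bornology.IsBounded Ω) (hc : IsConnected Ω)
    (hρ₀ : MemW1 Ω ∞ ρ₀) (hpos : 0 < rhoMin Ω ρ₀)
    (hρab : ∀ᵐ x ∂(vol Ω), rhoMin Ω ρ₀ ≤ ρ₀ x ∧ ρ₀ x ≤ rhoMax Ω ρ₀) {η : ℝ → ℝ}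
    (hη : ContinuousOn η (Set.Icc (rhoMin Ω ρ₀) (rhoMax Ω ρ₀)))
    (hr : r ∈ Set.Icc (rhoMin Ω ρ₀) (rhoMax Ω ρ₀)) : η r ≤ nuBar Ω η ρ₀ * r := by
  have hr0 : 0 < r := hpos.trans_le hr.1
  have h := hρ₀.abs_le_lpNorm_comp hΩ hb hc hρab (h := fun r => η r / r)
    (hη.div continuousOn_id fun s hs => (hpos.trans_le hs.1).ne') hr
  have h1 := (le_abs_self _).trans h
  rw [div_le_iff₀ hr0] at h1
  rw [nuBar]
  have h2 : 0 ≤ lpNorm (fun x => η (ρ₀ x) / ρ₀ x) ∞ (vol Ω) * r :=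
    mul_nonneg lpNorm_nonneg hr0.le
  linarith

theorem le_lamBar_mul (hΩ : IsOpen Ω) (hb : Bornology.IsBounded Ω) (hc : IsConnected Ω)
    (hρ₀ : MemW1 Ω ∞ ρ₀) (hpos : 0 < rhoMin Ω ρ₀)
    (hρab : ∀ᵐ x ∂(vol Ω), rhoMin Ω ρ₀ ≤ ρ₀ x ∧ ρ₀ x ≤ rhoMax Ω ρ₀) {lam : ℝ} (hlam : 0 ≤ lam)
    (hr : r ∈ Set.Icc (rhoMin Ω ρ₀) (rhoMax Ω ρ₀)) : lam ≤ lamBar Ω lam ρ₀ * r := by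
  have hr0 : 0 < r := hpos.trans_le hr.1
  have h := hρ₀.abs_le_lpNorm_comp hΩ hb hc hρab (h := fun r => 1 / r)
    (continuousOn_const.div continuousOn_id fun s hs => (hpos.trans_le hs.1).ne') hr
  have h1 := (le_abs_self _).trans h
  rw [div_le_iff₀ hr0] at h1
  rw [lamBar]
  have h2 := mul_le_mul_of_nonneg_left h1 hlam
  have h3 : 0 ≤ lam * (lpNorm (fun x => 1 / ρ₀ x) ∞ (vol Ω) * r) :=
    mul_nonneg hlam (mul_nonneg lpNorm_nonneg hr0.le)
  linarith

end Coefficients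

end VarDensityNS

/-! ### The energy inequality and the accumulated bound -/

open VarDensityNS
theorem theorem1 {d : ℕ} (hd : d = 2 ∨ d = 3) (Ω : Set (E d)) (hΩo : IsOpen Ω)
    (hΩb : Bornology.IsBounded Ω) (hΩc : IsConnected Ω) (ηmin : ℝ) (hηmin : 0 < ηmin) :
    ∃ C : ℝ, 0 < C ∧
      ∀ (η : ℝ → ℝ) (τ lam γ₁ γ₂ γ₃ γ₄ c₃ : ℝ) (ρ R p : ℕ → E d → ℝ) (m u f : ℕ → E d → E d),
      0 < τ → 0 < lam →
      -- the constants
      IsDivStrainConst Ω c₃ →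
      γ₁ ∈ Set.Ioo 0 (1 / √2) → γ₂ ∈ Set.Ioo 0 (1 / (√2 * c₃)) →
      γ₃ ∈ Set.Ioo (0 : ℝ) 1 → γ₄ ∈ Set.Ioo (0 : ℝ) 1 →
      -- the viscosity is a Lipschitz function of the density, bounded away from zero
      (∃ α : ℝ≥0, LipschitzOnWith α η (Set.Icc (rhoMin Ω (ρ 0)) (rhoMax Ω (ρ 0)))) →
      (∀ r ∈ Set.Icc (rhoMin Ω (ρ 0)) (rhoMax Ω (ρ 0)), ηmin ≤ η r) →
      -- the source terms and the scheme
      (∀ n, MemLp (f n) 2 (vol Ω)) →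
      IsSchemeSolution Ω η τ lam ρ R p m u f →
      -- the density satisfies the min-max principle
      0 < rhoMin Ω (ρ 0) →
      (∀ n, ∀ᵐ x ∂(vol Ω), rhoMin Ω (ρ 0) ≤ ρ n x ∧ ρ n x ≤ rhoMax Ω (ρ 0)) →
      -- the conditions on the time step
      (∀ n, √τ * lpNorm (fun x => (nuBar Ω η (ρ 0) * (2 * √2) / √(ρ n x * η (ρ (n + 1) x))) •
        grad Ω (ρ (n + 1)) x) ∞ (vol Ω) ≤ γ₁) →
      (∀ n, √τ * lpNorm (fun x => (lamBar Ω lam (ρ 0) * √2 / √(ρ n x * η (ρ (n + 1) x))) •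
        grad Ω (ρ (n + 1)) x) ∞ (vol Ω) ≤ γ₂) →
      -- the conditions on the density increments
      (∀ n, lpNorm (fun x => nuBar Ω η (ρ 0) * (ρ (n + 1) x - ρ n x) / η (ρ (n + 1) x)) ∞ (vol Ω)
        ≤ γ₃) →
      (∀ n, lpNorm (fun x => lamBar Ω lam (ρ 0) * (ρ (n + 1) x - ρ n x) / lam) ∞ (vol Ω) ≤ γ₄) →
      -- the energy inequality of one time step
      (∀ n : ℕ,
        normVec Ω (ρ (n + 1)) (u (n + 1)) ^ 2
          + 2 * τ * nuBar Ω η (ρ 0) * normStrain Ω (ρ (n + 1)) (u (n + 1)) ^ 2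
          + τ * lamBar Ω lam (ρ 0) * normDvg Ω (ρ (n + 1)) (u (n + 1)) ^ 2
          + τ / lam * lpNorm (p (n + 1)) 2 (vol Ω) ^ 2
          + τ * normStrain Ω (fun x => η (ρ (n + 1) x)) (u (n + 1)) ^ 2
        ≤ normVec Ω (ρ n) (u n) ^ 2
          + 2 * τ * nuBar Ω η (ρ 0) * normStrain Ω (ρ n) (u n) ^ 2
          + τ * lamBar Ω lam (ρ 0) * normDvg Ω (ρ n) (u n) ^ 2
          + τ / lam * lpNorm (p n) 2 (vol Ω) ^ 2
          + 2 * τ * lpNorm (f (n + 1)) 2 (vol Ω) * lpNorm (u (n + 1)) 2 (vol Ω))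
      ∧
      -- the resulting energy bound
      (∀ n : ℕ,
        normVec Ω (ρ (n + 1)) (u (n + 1)) ^ 2
        ≤ normVec Ω (ρ 0) (u 0) ^ 2
          + 2 * τ * nuBar Ω η (ρ 0) * normStrain Ω (ρ 0) (u 0) ^ 2
          + τ * lamBar Ω lam (ρ 0) * normDvg Ω (ρ 0) (u 0) ^ 2
          + τ / lam * lpNorm (p 0) 2 (vol Ω) ^ 2
          + C * τ * ∑ k ∈ Finset.range (n + 1), lpNorm (f (k + 1)) 2 (vol Ω) ^ 2) := by
  obtain ⟨K, hK, hKP⟩ := MemH10Vec.exists_lpNorm_sq_le (Ω := Ω) hd hΩo hΩb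
  -- `K` is the Korn–Poincaré constant of `Ω`; dividing by `ηmin` balances the force term against
  -- the viscous dissipation.
  refine ⟨K / ηmin, by positivity, ?_⟩
  intro η τ lam γ₁ γ₂ γ₃ γ₄ c₃ ρ R p m u f hτ hlam hc₃ hγ₁ hγ₂ hγ₃ hγ₄ hηLip hηle hf hsol hpos
    hρab ht1 ht2 hδ1 hδ2
  obtain ⟨α, hα⟩ := hηLip
  have hηc := hα.continuousOn
  set I := Set.Icc (rhoMin Ω (ρ 0)) (rhoMax Ω (ρ 0))
  have hnub := nuBar_nonneg (Ω := Ω) η (ρ 0)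
  have hlamb := lamBar_nonneg (Ω := Ω) hlam.le (ρ 0)
  set nub := nuBar Ω η (ρ 0)
  set lamb := lamBar Ω lam (ρ 0)
  have hηmem : ∀ n, MemLp (fun x => η (ρ n x)) ∞ (vol Ω) := fun n =>
    memLp_top_comp_of_continuousOn hηc (hsol.density_mem n).1.1 (hρab n)
  have hstep := hsol.isStep hf hpos (fun n => (hρab n).mono fun _ hx => hx.1) hηmem
  have hηae : ∀ n, ∀ᵐ x ∂(vol Ω), ηmin ≤ η (ρ n x) := fun n => (hρab n).mono fun x hx => hηle _ hx
  have hργ : ∀ n, ∀ᵐ x ∂(vol Ω), rhoMin Ω (ρ 0) * ηmin ≤ ρ n x * η (ρ (n + 1) x) := fun n => by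
    filter_upwards [hρab n, hηae (n + 1)] with x h1 h2
    exact mul_le_mul h1.1 h2 hηmin.le (hpos.le.trans h1.1)
  have hργm : ∀ n, AEStronglyMeasurable (fun x => ρ n x * η (ρ (n + 1) x)) (vol Ω) := fun n =>
    (hsol.density_mem n).1.1.mul (hηmem (n + 1)).1
  have hδmem : ∀ n, MemLp (fun x => ρ (n + 1) x - ρ n x) ∞ (vol Ω) := fun n =>
    (hsol.density_mem (n + 1)).1.sub (hsol.density_mem n).1
  -- The interval containing `γ₂` is nonempty, so its right end is positive; this also excludes `c₃
  -- = 0`, where division by zero would return zero.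
  have hc₃pos : 0 < c₃ := by
    have h1 : 0 < 1 / (√2 * c₃) := hγ₂.1.trans hγ₂.2
    exact pos_of_mul_pos_right (one_div_pos.1 h1) (Real.sqrt_nonneg 2)
  have hγ₁' : γ₁ ^ 2 ≤ 1 / 2 := by
    have h1 := pow_le_pow_left₀ hγ₁.1.le hγ₁.2.le 2
    rwa [div_pow, one_pow, Real.sq_sqrt zero_le_two] at h1
  have hγ₂' : γ₂ ^ 2 * c₃ ^ 2 ≤ 1 / 2 := by
    have h1 := pow_le_pow_left₀ hγ₂.1.le hγ₂.2.le 2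
    rw [div_pow, one_pow, mul_pow, Real.sq_sqrt zero_le_two, le_div_iff₀ (by positivity)] at h1
    linarith
  have main : ∀ n : ℕ,
        normVec Ω (ρ (n + 1)) (u (n + 1)) ^ 2
          + 2 * τ * nub * normStrain Ω (ρ (n + 1)) (u (n + 1)) ^ 2
          + τ * lamb * normDvg Ω (ρ (n + 1)) (u (n + 1)) ^ 2
          + τ / lam * lpNorm (p (n + 1)) 2 (vol Ω) ^ 2
          + τ * normStrain Ω (fun x => η (ρ (n + 1) x)) (u (n + 1)) ^ 2
        ≤ normVec Ω (ρ n) (u n) ^ 2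
          + 2 * τ * nub * normStrain Ω (ρ n) (u n) ^ 2
          + τ * lamb * normDvg Ω (ρ n) (u n) ^ 2
          + τ / lam * lpNorm (p n) 2 (vol Ω) ^ 2
          + 2 * τ * lpNorm (f (n + 1)) 2 (vol Ω) * lpNorm (u (n + 1)) 2 (vol Ω) := by
    intro n
    refine (hstep n).energy_le hd hΩo hΩb (γ₁ := γ₁) (γ₂ := γ₂) (c₃ := c₃) hτ hlam
      ((hρab n).mono fun x hx => hpos.le.trans hx.1)
      ((hρab (n + 1)).mono fun x hx => hpos.le.trans hx.1)
      ((hηae (n + 1)).mono fun x hx => hηmin.le.trans hx)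
      ((hρab (n + 1)).mono fun x hx =>
        le_nuBar_mul hΩo hΩb hΩc (hsol.density_mem 0) hpos (hρab 0) hηc hx)
      ((hρab (n + 1)).mono fun x hx =>
        le_lamBar_mul hΩo hΩb hΩc (hsol.density_mem 0) hpos (hρab 0) hlam.le hx)
      ?_ ?_ ?_ ?_ hγ₁' hγ₂' ?_
    · have hinv : MemLp (fun x => 1 / η (ρ (n + 1) x)) ∞ (vol Ω) :=
        memLp_top_comp_of_continuousOn (h := fun r => 1 / η r)
          (continuousOn_const.div hηc fun r hr => (hηmin.trans_le (hηle r hr)).ne')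
          (hsol.density_mem (n + 1)).1.1 (hρab (n + 1))
      have hmem : MemLp (fun x => nub * (ρ (n + 1) x - ρ n x) / η (ρ (n + 1) x)) ∞ (vol Ω) := by
        have h1 := memLp_mul_of_top hinv ((hδmem n).const_mul nub)
        refine (memLp_congr_ae (.of_forall fun x => ?_)).1 h1
        rw [one_div_mul_eq_div]
      filter_upwards [ae_le_lpNorm_exponent_top hmem, hηae (n + 1)] with x hx hxη
      have h1 := (le_abs_self _).trans (hx.trans ((hδ1 n).trans hγ₃.2.le))
      rwa [div_le_one (hηmin.trans_le hxη)] at h1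
    · have hmem : MemLp (fun x => lamb * (ρ (n + 1) x - ρ n x) / lam) ∞ (vol Ω) := by
        simp only [div_eq_mul_inv]
        exact ((hδmem n).const_mul lamb).mul_const _
      filter_upwards [ae_le_lpNorm_exponent_top hmem] with x hx
      have h1 := (le_abs_self _).trans (hx.trans ((hδ2 n).trans hγ₄.2.le))
      rwa [div_le_one hlam] at h1
    · filter_upwards [ae_mul_sum_sq_le_of_lpNorm_le hΩo hτ.le (mul_pos hpos hηmin) (hργm n)
        (hργ n) (hsol.density_mem (n + 1)) (ht1 n)] with x hx
      rw [mul_pow, mul_pow, Real.sq_sqrt zero_le_two] at hx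
      refine le_trans (le_of_eq ?_) hx
      ring
    · filter_upwards [ae_mul_sum_sq_le_of_lpNorm_le hΩo hτ.le (mul_pos hpos hηmin) (hργm n)
        (hργ n) (hsol.density_mem (n + 1)) (ht2 n)] with x hx
      rw [mul_pow, Real.sq_sqrt zero_le_two] at hx
      refine le_trans (le_of_eq ?_) hx
      ring
    -- The divergence bound is applied with the new viscosity as weight, hence the need for its
    -- lower and upper bounds.
    · refine hc₃ _ (hηmem (n + 1)).1 ⟨ηmin, lpNorm (fun x => η (ρ (n + 1) x)) ∞ (vol Ω), hηmin, ?_⟩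
        _ (hsol.velocity_mem (n + 1)).memH1Vec
      filter_upwards [hηae (n + 1), ae_le_lpNorm_exponent_top (hηmem (n + 1))] with x h1 h2
      exact ⟨h1, (le_abs_self _).trans h2⟩
  refine ⟨main, fun n => ?_⟩
  -- Young's inequality with weight `K / ηmin`, chosen so that the velocity part is at most the
  -- dissipation left on the left side of `main`.
  have hforce : ∀ n, 2 * τ * lpNorm (f (n + 1)) 2 (vol Ω) * lpNorm (u (n + 1)) 2 (vol Ω) ≤
      K / ηmin * τ * lpNorm (f (n + 1)) 2 (vol Ω) ^ 2 +
        τ * normStrain Ω (fun x => η (ρ (n + 1) x)) (u (n + 1)) ^ 2 := by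
    intro n
    have hu := (hsol.velocity_mem (n + 1)).memH1Vec
    have h1 := hKP _ (hsol.velocity_mem (n + 1))
    have h2 : ηmin * ∫ x in Ω, contr (strain Ω (u (n + 1)) x) (strain Ω (u (n + 1)) x) ≤
        normStrain Ω (fun x => η (ρ (n + 1) x)) (u (n + 1)) ^ 2 :=
      ((IntegralEq.of_integrable (hu.integrable_contr_strain hΩo)).const_mul ηmin).mono_ae
        (hu.integralEq_normStrain hΩo (hηmem (n + 1))
          ((hηae (n + 1)).mono fun x hx => hηmin.le.trans hx))
        ((hηae (n + 1)).mono fun x hx => mul_le_mul_of_nonneg_right hx (contr_self_nonneg _))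
    set A := lpNorm (f (n + 1)) 2 (vol Ω)
    set B := lpNorm (u (n + 1)) 2 (vol Ω)
    have h3 : ηmin / K * B ^ 2 ≤ normStrain Ω (fun x => η (ρ (n + 1) x)) (u (n + 1)) ^ 2 := by
      refine le_trans ?_ h2
      rw [div_mul_eq_mul_div, div_le_iff₀ hK, mul_assoc]
      refine mul_le_mul_of_nonneg_left ?_ hηmin.le
      rwa [mul_comm _ K]
    have h4 : 2 * A * B ≤ K / ηmin * A ^ 2 + ηmin / K * B ^ 2 := by
      have h5 : 0 ≤ K / ηmin * (A - ηmin / K * B) ^ 2 := by positivity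
      have h6 : K / ηmin * (A - ηmin / K * B) ^ 2 =
          K / ηmin * A ^ 2 + ηmin / K * B ^ 2 - 2 * A * B := by
        field_simp
        ring
      linarith
    calc 2 * τ * A * B = τ * (2 * A * B) := by ring
      _ ≤ τ * (K / ηmin * A ^ 2 + normStrain Ω (fun x => η (ρ (n + 1) x)) (u (n + 1)) ^ 2) :=
        mul_le_mul_of_nonneg_left (h4.trans (by linarith)) hτ.le
      _ = _ := by ring
  -- The full discrete energy telescopes, with the dissipation spent on the force at each step; its
  -- viscous, divergence and pressure parts are dropped only at the end.
  have hind : ∀ n : ℕ,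
      normVec Ω (ρ n) (u n) ^ 2 + 2 * τ * nub * normStrain Ω (ρ n) (u n) ^ 2
          + τ * lamb * normDvg Ω (ρ n) (u n) ^ 2 + τ / lam * lpNorm (p n) 2 (vol Ω) ^ 2
        ≤ normVec Ω (ρ 0) (u 0) ^ 2 + 2 * τ * nub * normStrain Ω (ρ 0) (u 0) ^ 2
          + τ * lamb * normDvg Ω (ρ 0) (u 0) ^ 2 + τ / lam * lpNorm (p 0) 2 (vol Ω) ^ 2
          + K / ηmin * τ * ∑ k ∈ Finset.range n, lpNorm (f (k + 1)) 2 (vol Ω) ^ 2 := by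
    intro n
    induction n with
    | zero => simp
    | succ n ih =>
      rw [Finset.sum_range_succ, mul_add]
      linarith [main n, hforce n]
  have h0 := hind (n + 1)
  have p1 : 0 ≤ 2 * τ * nub * normStrain Ω (ρ (n + 1)) (u (n + 1)) ^ 2 := by positivity
  have p2 : 0 ≤ τ * lamb * normDvg Ω (ρ (n + 1)) (u (n + 1)) ^ 2 := by positivity
  have p3 : 0 ≤ τ / lam * lpNorm (p (n + 1)) 2 (vol Ω) ^ 2 := by positivity
  linarith
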